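/- Let $\mathbb{D}$ be the open unit disk in $\mathbb{C}$, let $0<\alpha<\infty$ and $0<\beta<\infty$, let $u$ be analytic on $\mathbb{D}$ and let $\varphi$ be an analytic self-map of $\mathbb{D}$. Let $\mathcal{B}^\alpha$ be the space of analytic functions $f$ on $\mathbb{D}$ with finite norm $|f(0)|+\sup_{z\in\mathbb{D}}(1-|z|^2)^\alpha|f'(z)|$, and let $\mathcal{Z}_\beta$ be the space of analytic functions $f$ on $\mathbb{D}$ with finite norm $|f(0)|+|f'(0)|+\sup_{z\in\mathbb{D}}(1-|z|^2)^\beta|f''(z)|$. Write $(uC_\varphi f)(z)=u(z)f(\varphi(z))$, $\|g\|_{\nu_\beta}=\sup_{z\in\mathbb{D}}(1-|z|^2)^\beta|g(z)|\in[0,\infty]$, and $\varphi^n$ for the $n$-th power $z\mapsto\varphi(z)^n$. Then the following are equivalent. (a) $uC_\varphi:\mathcal{B}^\alpha\to\mathcal{Z}_\beta$ is compact. (b) $uC_\varphi:\mathcal{B}^\alpha\to\mathcal{Z}_\beta$ is bounded, $$\limsup_{n\to\infty}(n+1)^\alpha\|(2u'\varphi'+u\varphi'')\varphi^n\|_{\nu_\beta}=0,\qquad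 \limsup_{n\to\infty}(n+1)^{\alpha+1}\|u(\varphi')^2\varphi^n\|_{\nu_\beta}=0,$$ and moreover, if $\alpha=1$, then $\limsup_{n\to\infty}(\log n)\|u''\varphi^n\|_{\nu_\beta}=0$, and, if $\alpha>1$, then $\limsup_{n\to\infty}(n+1)^{\alpha-1}\|u''\varphi^n\|_{\nu_\beta}=0$. (In (a) and (b), "compact" and "bounded" include that $uC_\varphi$ maps $\mathcal{B}^\alpha$ into $\mathcal{Z}_\beta$.) -/

import Mathlib

open Filter
open scoped ENNReal

noncomputable section

namespace BlochZygmund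

/-- The open unit disk. -/
abbrev disk : Set ℂ := Metric.ball 0 1

/-- The weighted supremum `‖f‖_{ν_γ} = sup_{z ∈ 𝔻} (1 - |z|²)^γ |f z|`, with values in `[0, ∞]`. -/
def weightedSup (γ : ℝ) (f : ℂ → ℂ) : ℝ≥0∞ :=
  ⨆ z : disk, ENNReal.ofReal ((1 - ‖(z : ℂ)‖ ^ 2) ^ γ * ‖f z‖)

theorem weight_pos (γ : ℝ) (z : disk) : 0 < (1 - ‖(z : ℂ)‖ ^ 2) ^ γ := by
  have h : ‖(z : ℂ)‖ < 1 := mem_ball_zero_iff.1 z.2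
  apply Real.rpow_pos_of_pos
  nlinarith [norm_nonneg (z : ℂ)]

theorem weightedSup_congr {γ : ℝ} {f g : ℂ → ℂ} (h : Set.EqOn f g disk) :
    weightedSup γ f = weightedSup γ g :=
  iSup_congr fun z => by rw [h z.2]

theorem weightedSup_zero (γ : ℝ) : weightedSup γ (fun _ => 0) = 0 := by
  simp [weightedSup]

theorem weightedSup_add_le (γ : ℝ) (f g : ℂ → ℂ) :
    weightedSup γ (fun z => f z + g z) ≤ weightedSup γ f + weightedSup γ g := by
  refine iSup_le fun z => ?_
  have hw := (weight_pos γ z).le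
  calc ENNReal.ofReal ((1 - ‖(z : ℂ)‖ ^ 2) ^ γ * ‖f z + g z‖)
      ≤ ENNReal.ofReal ((1 - ‖(z : ℂ)‖ ^ 2) ^ γ * ‖f z‖ + (1 - ‖(z : ℂ)‖ ^ 2) ^ γ * ‖g z‖) := by
        apply ENNReal.ofReal_le_ofReal
        rw [← mul_add]
        exact mul_le_mul_of_nonneg_left (norm_add_le _ _) hw
    _ = ENNReal.ofReal ((1 - ‖(z : ℂ)‖ ^ 2) ^ γ * ‖f z‖)
          + ENNReal.ofReal ((1 - ‖(z : ℂ)‖ ^ 2) ^ γ * ‖g z‖) :=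
        ENNReal.ofReal_add (by positivity) (by positivity)
    _ ≤ _ := add_le_add
        (le_iSup (fun z : disk => ENNReal.ofReal ((1 - ‖(z : ℂ)‖ ^ 2) ^ γ * ‖f z‖)) z)
        (le_iSup (fun z : disk => ENNReal.ofReal ((1 - ‖(z : ℂ)‖ ^ 2) ^ γ * ‖g z‖)) z)

theorem weightedSup_smul (γ : ℝ) (c : ℂ) (f : ℂ → ℂ) :
    weightedSup γ (fun z => c * f z) = ENNReal.ofReal ‖c‖ * weightedSup γ f := by
  unfold weightedSup
  rw [ENNReal.mul_iSup]
  refine iSup_congr fun z => ?_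
  rw [← ENNReal.ofReal_mul (norm_nonneg c), norm_mul]
  congr 1
  ring

theorem eqOn_zero_of_weightedSup {γ : ℝ} {f : ℂ → ℂ} (h : weightedSup γ f = 0) :
    ∀ z ∈ disk, f z = 0 := by
  intro z hz
  have h1 := ENNReal.iSup_eq_zero.1 h ⟨z, hz⟩
  have h2 := ENNReal.ofReal_eq_zero.1 h1
  have h3 := weight_pos γ ⟨z, hz⟩
  have h4 : ‖f z‖ ≤ 0 := by
    by_contra hc
    exact absurd h2 (not_le.2 (mul_pos h3 (not_le.1 hc)))
  simpa using h4

/-- `H(𝔻)`: the functions analytic on the unit disk. Such a function is represented by its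
extension by zero to the whole plane, so that equality in this type is equality on the disk. -/
def holo : Submodule ℂ (ℂ → ℂ) where
  carrier := {f | DifferentiableOn ℂ f disk ∧ ∀ z ∉ disk, f z = 0}
  add_mem' := fun hf hg => ⟨hf.1.add hg.1, fun z hz => by simp [hf.2 z hz, hg.2 z hz]⟩
  zero_mem' := ⟨differentiableOn_const 0, fun _ _ => rfl⟩
  smul_mem' := fun c _ hf => ⟨hf.1.const_smul c, fun z hz => by simp [hf.2 z hz]⟩

theorem holo_diff {f : ℂ → ℂ} (hf : f ∈ holo) {z : ℂ} (hz : z ∈ disk) :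
    DifferentiableAt ℂ f z :=
  hf.1.differentiableAt (Metric.isOpen_ball.mem_nhds hz)

theorem holo_diff_deriv {f : ℂ → ℂ} (hf : f ∈ holo) {z : ℂ} (hz : z ∈ disk) :
    DifferentiableAt ℂ (deriv f) z :=
  (hf.1.deriv Metric.isOpen_ball).differentiableAt (Metric.isOpen_ball.mem_nhds hz)

theorem deriv_add_on {f g : ℂ → ℂ} (hf : f ∈ holo) (hg : g ∈ holo) :
    Set.EqOn (deriv (f + g)) (fun z => deriv f z + deriv g z) disk :=
  fun _ hz => deriv_add (holo_diff hf hz) (holo_diff hg hz)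

theorem deriv_smul_on {f : ℂ → ℂ} (c : ℂ) (hf : f ∈ holo) :
    Set.EqOn (deriv (c • f)) (fun z => c * deriv f z) disk :=
  fun _ hz => deriv_const_smul c (holo_diff hf hz)

theorem deriv2_add_on {f g : ℂ → ℂ} (hf : f ∈ holo) (hg : g ∈ holo) :
    Set.EqOn (deriv (deriv (f + g))) (fun z => deriv (deriv f) z + deriv (deriv g) z) disk := by
  intro z hz
  rw [((deriv_add_on hf hg).eventuallyEq_of_mem (Metric.isOpen_ball.mem_nhds hz)).deriv_eq]
  exact deriv_add (holo_diff_deriv hf hz) (holo_diff_deriv hg hz)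

theorem deriv2_smul_on {f : ℂ → ℂ} (c : ℂ) (hf : f ∈ holo) :
    Set.EqOn (deriv (deriv (c • f))) (fun z => c * deriv (deriv f) z) disk := by
  intro z hz
  rw [((deriv_smul_on c hf).eventuallyEq_of_mem (Metric.isOpen_ball.mem_nhds hz)).deriv_eq]
  exact deriv_const_mul c (holo_diff_deriv hf hz)

theorem eqOn_zero_of_deriv {f : ℂ → ℂ} (hd : DifferentiableOn ℂ f disk)
    (h : ∀ z ∈ disk, deriv f z = 0) (h0 : f 0 = 0) : ∀ z ∈ disk, f z = 0 := by
  intro z hz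
  have := Metric.isOpen_ball.is_const_of_deriv_eq_zero
    (convex_ball (0 : ℂ) 1).isPreconnected hd h hz (Metric.mem_ball_self one_pos)
  rw [this, h0]

theorem zero_mem_disk : (0 : ℂ) ∈ disk := Metric.mem_ball_self one_pos

/-- The Bloch type space `𝓑^α`, as a linear subspace of the functions on the plane. -/
def blochSubmodule (α : ℝ) : Submodule ℂ (ℂ → ℂ) where
  carrier := {f | f ∈ holo ∧ weightedSup α (deriv f) < ∞}
  add_mem' := by
    rintro f g ⟨hf, hf'⟩ ⟨hg, hg'⟩
    refine ⟨holo.add_mem hf hg, ?_⟩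
    rw [weightedSup_congr (deriv_add_on hf hg)]
    exact (weightedSup_add_le _ _ _).trans_lt (ENNReal.add_lt_top.2 ⟨hf', hg'⟩)
  zero_mem' := ⟨holo.zero_mem, by simp [weightedSup, Pi.zero_def]⟩
  smul_mem' := by
    rintro c f ⟨hf, hf'⟩
    refine ⟨holo.smul_mem c hf, ?_⟩
    rw [weightedSup_congr (deriv_smul_on c hf), weightedSup_smul]
    exact ENNReal.mul_lt_top ENNReal.ofReal_lt_top hf'

/-- The Zygmund type space `𝓩_β`, as a linear subspace of the functions on the plane. -/
def zygmundSubmodule (β : ℝ) : Submodule ℂ (ℂ → ℂ) where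
  carrier := {f | f ∈ holo ∧ weightedSup β (deriv (deriv f)) < ∞}
  add_mem' := by
    rintro f g ⟨hf, hf'⟩ ⟨hg, hg'⟩
    refine ⟨holo.add_mem hf hg, ?_⟩
    rw [weightedSup_congr (deriv2_add_on hf hg)]
    exact (weightedSup_add_le _ _ _).trans_lt (ENNReal.add_lt_top.2 ⟨hf', hg'⟩)
  zero_mem' := ⟨holo.zero_mem, by simp [weightedSup, Pi.zero_def]⟩
  smul_mem' := by
    rintro c f ⟨hf, hf'⟩
    refine ⟨holo.smul_mem c hf, ?_⟩
    rw [weightedSup_congr (deriv2_smul_on c hf), weightedSup_smul]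
    exact ENNReal.mul_lt_top ENNReal.ofReal_lt_top hf'

/-- The Bloch type space `𝓑^α` as a type of its own, so that its only topology is the one of the
norm below (and not the topology of pointwise convergence). -/
def Bloch (α : ℝ) : Type := blochSubmodule α

/-- The Zygmund type space `𝓩_β` as a type of its own, with the topology of the norm below. -/
def Zygmund (β : ℝ) : Type := zygmundSubmodule β

instance (α : ℝ) : AddCommGroup (Bloch α) := inferInstanceAs (AddCommGroup (blochSubmodule α))

instance (α : ℝ) : Module ℂ (Bloch α) := inferInstanceAs (Module ℂ (blochSubmodule α))

instance (β : ℝ) : AddCommGroup (Zygmund β) :=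
  inferInstanceAs (AddCommGroup (zygmundSubmodule β))

instance (β : ℝ) : Module ℂ (Zygmund β) := inferInstanceAs (Module ℂ (zygmundSubmodule β))

/-- The function that an element of `𝓑^α` is. -/
def Bloch.toFun {α : ℝ} (f : Bloch α) : ℂ → ℂ := f.1

/-- The function that an element of `𝓩_β` is. -/
def Zygmund.toFun {β : ℝ} (f : Zygmund β) : ℂ → ℂ := f.1

theorem Bloch.toFun_smul {α : ℝ} (c : ℂ) (f : Bloch α) : (c • f).toFun = c • f.toFun := rfl

theorem Bloch.toFun_add {α : ℝ} (f g : Bloch α) : (f + g).toFun = f.toFun + g.toFun := rfl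

theorem Bloch.toFun_zero {α : ℝ} : (0 : Bloch α).toFun = 0 := rfl

theorem Bloch.mem {α : ℝ} (f : Bloch α) :
    f.toFun ∈ holo ∧ weightedSup α (deriv f.toFun) < ∞ := f.2

theorem Zygmund.toFun_smul {β : ℝ} (c : ℂ) (f : Zygmund β) : (c • f).toFun = c • f.toFun := rfl

theorem Zygmund.toFun_add {β : ℝ} (f g : Zygmund β) : (f + g).toFun = f.toFun + g.toFun := rfl

theorem Zygmund.toFun_zero {β : ℝ} : (0 : Zygmund β).toFun = 0 := rfl

theorem Zygmund.mem {β : ℝ} (f : Zygmund β) :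
    f.toFun ∈ holo ∧ weightedSup β (deriv (deriv f.toFun)) < ∞ := f.2

/-- `‖f‖ = |f(0)| + sup_{z ∈ 𝔻} (1 - |z|²)^α |f'(z)|`. -/
instance (α : ℝ) : Norm (Bloch α) where
  norm f := ‖f.toFun 0‖ + (weightedSup α (deriv f.toFun)).toReal

/-- `‖f‖ = |f(0)| + |f'(0)| + sup_{z ∈ 𝔻} (1 - |z|²)^β |f''(z)|`. -/
instance (β : ℝ) : Norm (Zygmund β) where
  norm f := ‖f.toFun 0‖ + ‖deriv f.toFun 0‖
    + (weightedSup β (deriv (deriv f.toFun))).toReal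

theorem Bloch.norm_def {α : ℝ} (f : Bloch α) :
    ‖f‖ = ‖f.toFun 0‖ + (weightedSup α (deriv f.toFun)).toReal := rfl

theorem Zygmund.norm_def {β : ℝ} (f : Zygmund β) :
    ‖f‖ = ‖f.toFun 0‖ + ‖deriv f.toFun 0‖
      + (weightedSup β (deriv (deriv f.toFun))).toReal := rfl

theorem Bloch.core (α : ℝ) : NormedSpace.Core ℂ (Bloch α) where
  norm_nonneg f := by rw [Bloch.norm_def]; positivity
  norm_smul c f := by
    simp only [Bloch.norm_def, Bloch.toFun_smul]
    rw [weightedSup_congr (deriv_smul_on c f.mem.1), weightedSup_smul, ENNReal.toReal_mul,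
      ENNReal.toReal_ofReal (norm_nonneg c)]
    simp [mul_add]
  norm_triangle f g := by
    simp only [Bloch.norm_def, Bloch.toFun_add]
    rw [weightedSup_congr (deriv_add_on f.mem.1 g.mem.1)]
    have h1 := ENNReal.toReal_mono (ENNReal.add_lt_top.2 ⟨f.mem.2, g.mem.2⟩).ne
      (weightedSup_add_le α (deriv f.toFun) (deriv g.toFun))
    rw [ENNReal.toReal_add f.mem.2.ne g.mem.2.ne] at h1
    have h2 := norm_add_le (f.toFun 0) (g.toFun 0)
    simp only [Pi.add_apply]
    linarith
  norm_eq_zero_iff f := by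
    constructor
    · intro h
      rw [Bloch.norm_def] at h
      have ha := norm_nonneg (f.toFun 0)
      have hb : 0 ≤ (weightedSup α (deriv f.toFun)).toReal := ENNReal.toReal_nonneg
      have h0 : f.toFun 0 = 0 := norm_eq_zero.1 (by linarith)
      have h1 : weightedSup α (deriv f.toFun) = 0 :=
        ((ENNReal.toReal_eq_zero_iff _).1 (by linarith)).resolve_right f.mem.2.ne
      have h2 := eqOn_zero_of_deriv f.mem.1.1 (eqOn_zero_of_weightedSup h1) h0
      refine Subtype.ext (funext fun z => ?_)
      by_cases hz : z ∈ disk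
      · exact h2 z hz
      · exact f.mem.1.2 z hz
    · rintro rfl
      simp [Bloch.norm_def, Bloch.toFun_zero, weightedSup, Pi.zero_def]

theorem Zygmund.core (β : ℝ) : NormedSpace.Core ℂ (Zygmund β) where
  norm_nonneg f := by rw [Zygmund.norm_def]; positivity
  norm_smul c f := by
    simp only [Zygmund.norm_def, Zygmund.toFun_smul]
    rw [weightedSup_congr (deriv2_smul_on c f.mem.1), weightedSup_smul, ENNReal.toReal_mul,
      ENNReal.toReal_ofReal (norm_nonneg c), deriv_smul_on c f.mem.1 zero_mem_disk]
    simp [mul_add]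
  norm_triangle f g := by
    simp only [Zygmund.norm_def, Zygmund.toFun_add]
    rw [weightedSup_congr (deriv2_add_on f.mem.1 g.mem.1), deriv_add_on f.mem.1 g.mem.1 zero_mem_disk]
    have h1 := ENNReal.toReal_mono (ENNReal.add_lt_top.2 ⟨f.mem.2, g.mem.2⟩).ne
      (weightedSup_add_le β (deriv (deriv f.toFun)) (deriv (deriv g.toFun)))
    rw [ENNReal.toReal_add f.mem.2.ne g.mem.2.ne] at h1
    have h2 := norm_add_le (f.toFun 0) (g.toFun 0)
    have h3 := norm_add_le (deriv f.toFun 0) (deriv g.toFun 0)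
    simp only [Pi.add_apply]
    linarith
  norm_eq_zero_iff f := by
    constructor
    · intro h
      rw [Zygmund.norm_def] at h
      have ha := norm_nonneg (f.toFun 0)
      have hc := norm_nonneg (deriv f.toFun 0)
      have hb : 0 ≤ (weightedSup β (deriv (deriv f.toFun))).toReal := ENNReal.toReal_nonneg
      have h0 : f.toFun 0 = 0 := norm_eq_zero.1 (by linarith)
      have h0' : deriv f.toFun 0 = 0 := norm_eq_zero.1 (by linarith)
      have h1 : weightedSup β (deriv (deriv f.toFun)) = 0 :=
        ((ENNReal.toReal_eq_zero_iff _).1 (by linarith)).resolve_right f.mem.2.ne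
      have h2 := eqOn_zero_of_deriv (f.mem.1.1.deriv Metric.isOpen_ball)
        (eqOn_zero_of_weightedSup h1) h0'
      have h3 := eqOn_zero_of_deriv f.mem.1.1 h2 h0
      refine Subtype.ext (funext fun z => ?_)
      by_cases hz : z ∈ disk
      · exact h3 z hz
      · exact f.mem.1.2 z hz
    · rintro rfl
      simp [Zygmund.norm_def, Zygmund.toFun_zero, weightedSup, Pi.zero_def]

instance (α : ℝ) : NormedAddCommGroup (Bloch α) := NormedAddCommGroup.ofCore (Bloch.core α)

instance (α : ℝ) : NormedSpace ℂ (Bloch α) := NormedSpace.ofCore (Bloch.core α)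

instance (β : ℝ) : NormedAddCommGroup (Zygmund β) := NormedAddCommGroup.ofCore (Zygmund.core β)

instance (β : ℝ) : NormedSpace ℂ (Zygmund β) := NormedSpace.ofCore (Zygmund.core β)

/-- The linear map `T : 𝓑^α → 𝓩_β` is the weighted composition operator
`uC_φ f (z) = u(z) f(φ(z))`, `z ∈ 𝔻`. Such a `T` is unique, and it exists exactly when `uC_φ`
maps `𝓑^α` into `𝓩_β`. -/
def IsWeightedComp {α β : ℝ} (u φ : ℂ → ℂ) (T : Bloch α →ₗ[ℂ] Zygmund β) : Prop :=
  ∀ f : Bloch α, ∀ z ∈ disk, (T f).toFun z = u z * f.toFun (φ z)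

/-- `uC_φ : 𝓑^α → 𝓩_β` is a bounded operator. -/
def BoundedWeightedComp (α β : ℝ) (u φ : ℂ → ℂ) : Prop :=
  ∃ T : Bloch α →ₗ[ℂ] Zygmund β, IsWeightedComp u φ T ∧ ∃ C : ℝ, ∀ f, ‖T f‖ ≤ C * ‖f‖

/-- `uC_φ : 𝓑^α → 𝓩_β` is a compact operator. -/
def CompactWeightedComp (α β : ℝ) (u φ : ℂ → ℂ) : Prop :=
  ∃ T : Bloch α →ₗ[ℂ] Zygmund β, IsWeightedComp u φ T ∧ IsCompactOperator T

end BlochZygmund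

end

open Filter
open scoped ENNReal Topology

noncomputable section

namespace BlochZygmund

/-! With `X = u''`, `A = 2u'φ' + uφ''` and `B = u(φ')²`, one has `(uC_φ f)'' = X·f∘φ + A·f'∘φ +
B·f''∘φ`. On the unit ball of `𝓑^α`, `f'` and `f''` grow at most like `(1-|w|)^(-α)` and
`(1-|w|)^(-α-1)`, while `f` is bounded for `α < 1` and grows like `-log(1-|w|)` for `α = 1` and like
`(1-|w|)^(1-α)` for `α > 1`. Taking `n` close to `1/(2(1-|φ z|))` makes `|φ z|^n ≥ 1/2`, so the
limsup conditions say that each weighted coefficient, times its growth rate, is small as `|φ z| → 1`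
(`exists_nat_of_tendsto`).

Sufficiency. By normal families, compactness follows once `‖T H‖ → 0` along norm-bounded families `H
→ 0` locally uniformly (`isCompactOperator_of_tendsto_norm`). Where `|φ z|` stays away from 1, local
uniform convergence and bounded coefficients suffice; near 1 the boundary estimates take over
(`tendsto_norm_apply`). For `α < 1` the term `X·f∘φ` needs no decay, because `f` varies little along
a radius near the circle.

Necessity. A compact `T` sends bounded, pointwise null sequences to norm null ones
(`tendsto_norm_of_isCompactOperator`). The functions `n^(α-1) z^n` form such a sequence, and the
exponents `n, 2n, 3n` together isolate `X`, `A` and `B` (`separate_coefficients`). For `α = 1`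
monomials miss the logarithm; rotated segments of the series of `-log(1-z)` recover it
(`log_mul_pow_le_norm_logSegment`). -/

theorem norm_lt_one {z : ℂ} (hz : z ∈ disk) : ‖z‖ < 1 := mem_ball_zero_iff.1 hz

theorem mem_disk {z : ℂ} (hz : ‖z‖ < 1) : z ∈ disk := mem_ball_zero_iff.2 hz

theorem weight_pos' (γ : ℝ) {z : ℂ} (hz : z ∈ disk) : 0 < (1 - ‖z‖ ^ 2) ^ γ := weight_pos γ ⟨z, hz⟩

theorem le_weightedSup {γ : ℝ} {f : ℂ → ℂ} (h : weightedSup γ f < ∞) {z : ℂ} (hz : z ∈ disk) :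
    (1 - ‖z‖ ^ 2) ^ γ * ‖f z‖ ≤ (weightedSup γ f).toReal := by
  have h1 : ENNReal.ofReal ((1 - ‖z‖ ^ 2) ^ γ * ‖f z‖) ≤ weightedSup γ f :=
    le_iSup (fun z : disk => ENNReal.ofReal ((1 - ‖(z : ℂ)‖ ^ 2) ^ γ * ‖f z‖)) ⟨z, hz⟩
  exact (ENNReal.ofReal_le_iff_le_toReal h.ne).1 h1

theorem weightedSup_le {γ C : ℝ} {f : ℂ → ℂ}
    (h : ∀ z ∈ disk, (1 - ‖z‖ ^ 2) ^ γ * ‖f z‖ ≤ C) : weightedSup γ f ≤ ENNReal.ofReal C :=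
  iSup_le fun z => ENNReal.ofReal_le_ofReal (h z z.2)

theorem weightedSup_toReal_le {γ C : ℝ} {f : ℂ → ℂ} (hC : 0 ≤ C)
    (h : ∀ z ∈ disk, (1 - ‖z‖ ^ 2) ^ γ * ‖f z‖ ≤ C) : (weightedSup γ f).toReal ≤ C :=
  ENNReal.toReal_le_of_le_ofReal hC (weightedSup_le h)

theorem one_sub_sq_ge {z : ℂ} (hz : z ∈ disk) : 1 - ‖z‖ ≤ 1 - ‖z‖ ^ 2 := by
  nlinarith [norm_lt_one hz, norm_nonneg z]

/-! ### Growth of Bloch type functions and of their derivatives. -/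

namespace Bloch

variable {α : ℝ}

theorem weight_mul_deriv_le (f : Bloch α) {z : ℂ} (hz : z ∈ disk) :
    (1 - ‖z‖ ^ 2) ^ α * ‖deriv f.toFun z‖ ≤ ‖f‖ := by
  have := le_weightedSup f.mem.2 hz
  have h2 := norm_nonneg (f.toFun 0)
  rw [Bloch.norm_def]
  linarith

theorem norm_apply_zero_le (f : Bloch α) : ‖f.toFun 0‖ ≤ ‖f‖ := by
  rw [Bloch.norm_def]
  linarith [ENNReal.toReal_nonneg (a := weightedSup α (deriv f.toFun))]

theorem norm_deriv_le (hα : 0 < α) (f : Bloch α) {z : ℂ} (hz : z ∈ disk) :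
    ‖deriv f.toFun z‖ ≤ ‖f‖ * (1 - ‖z‖) ^ (-α) := by
  have h0 : 0 < 1 - ‖z‖ := by linarith [norm_lt_one hz]
  have h1 := f.weight_mul_deriv_le hz
  have h2 : (1 - ‖z‖) ^ α ≤ (1 - ‖z‖ ^ 2) ^ α :=
    Real.rpow_le_rpow h0.le (one_sub_sq_ge hz) hα.le
  have h3 := Real.rpow_pos_of_pos h0 α
  rw [Real.rpow_neg h0.le, ← div_eq_mul_inv, le_div_iff₀ h3]
  nlinarith [norm_nonneg (deriv f.toFun z)]

/-- Cauchy's estimate for `f'` on the circle of radius `(1-‖z‖)/2` about `z`; halving the distance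
to the boundary costs the factor `2^(α+1)`. -/
theorem norm_deriv_deriv_le (hα : 0 < α) (f : Bloch α) {z : ℂ} (hz : z ∈ disk) :
    ‖deriv (deriv f.toFun) z‖ ≤ 2 ^ (α + 1) * ‖f‖ * (1 - ‖z‖) ^ (-(α + 1)) := by
  have h0 : 0 < 1 - ‖z‖ := by linarith [norm_lt_one hz]
  have hsub : ∀ w ∈ Metric.closedBall z ((1 - ‖z‖) / 2), ‖w‖ ≤ 1 - (1 - ‖z‖) / 2 := by
    intro w hw
    rw [mem_closedBall_iff_norm] at hw
    have := norm_le_norm_add_norm_sub' w z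
    linarith
  have hdisk : ∀ w ∈ Metric.closedBall z ((1 - ‖z‖) / 2), w ∈ disk := fun w hw =>
    mem_disk (by linarith [hsub w hw])
  have key : ‖deriv (deriv f.toFun) z‖ ≤ (‖f‖ * ((1 - ‖z‖) / 2) ^ (-α)) / ((1 - ‖z‖) / 2) := by
    apply Complex.norm_deriv_le_of_forall_mem_sphere_norm_le (by linarith)
    · apply DifferentiableOn.diffContOnCl
      refine (f.mem.1.1.deriv Metric.isOpen_ball).mono fun w hw => ?_
      exact hdisk w (Metric.closure_ball_subset_closedBall hw)
    · intro w hw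
      have hw' := Metric.sphere_subset_closedBall hw
      refine (f.norm_deriv_le hα (hdisk w hw')).trans ?_
      refine mul_le_mul_of_nonneg_left ?_ (norm_nonneg f)
      apply Real.rpow_le_rpow_of_nonpos (by linarith) (by linarith [hsub w hw']) (by linarith)
  refine key.trans_eq ?_
  rw [Real.div_rpow h0.le (by norm_num), neg_add, Real.rpow_add h0, Real.rpow_add (by norm_num),
    Real.rpow_neg_one, Real.rpow_neg (by norm_num : (0 : ℝ) ≤ 2), Real.rpow_one]
  field_simp

/-- The bound on `f'` is integrated along a radius. The antiderivative `B` is left abstract because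
it is a logarithm for `α = 1` and a power otherwise. -/
theorem norm_apply_radial_le (hα : 0 < α) (f : Bloch α) {ζ : ℂ} (hζ : ‖ζ‖ = 1) {B : ℝ → ℝ}
    (hB : ∀ x ∈ Set.Ico (0 : ℝ) 1, HasDerivAt B ((1 - x) ^ (-α)) x) {s t : ℝ} (hs : 0 ≤ s)
    (hst : s ≤ t) (ht : t < 1) :
    ‖f.toFun (t * ζ)‖ ≤ ‖f.toFun (s * ζ)‖ + ‖f‖ * (B t - B s) := by
  have hmem : ∀ x ∈ Set.Icc s t, (x : ℂ) * ζ ∈ disk ∧ ‖(x : ℂ) * ζ‖ = x := by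
    intro x hx
    have : ‖(x : ℂ) * ζ‖ = x := by
      rw [norm_mul, hζ, mul_one, Complex.norm_real, Real.norm_of_nonneg (hs.trans hx.1)]
    exact ⟨mem_disk (by linarith [hx.2]), this⟩
  have hd : ∀ x ∈ Set.Icc s t, HasDerivAt (fun x : ℝ => f.toFun (x * ζ))
      (deriv f.toFun (x * ζ) * ζ) x := by
    intro x hx
    have h1 := (holo_diff f.mem.1 (hmem x hx).1).hasDerivAt
    have h2 : HasDerivAt (fun x : ℝ => (x : ℂ) * ζ) ζ x := by
      simpa using (Complex.ofRealCLM.hasDerivAt (x := x)).mul_const ζ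
    exact h1.comp x h2
  have hB' : ∀ x ∈ Set.Icc s t, HasDerivAt
      (fun x => ‖f.toFun (s * ζ)‖ + ‖f‖ * (B x - B s)) (‖f‖ * (1 - x) ^ (-α)) x := by
    intro x hx
    exact (((hB x ⟨hs.trans hx.1, hx.2.trans_lt ht⟩).sub_const (B s)).const_mul _).const_add _
  refine image_norm_le_of_norm_deriv_right_le_deriv_boundary' (a := s) (b := t)
    (fun x hx => (hd x hx).continuousAt.continuousWithinAt)
    (fun x hx => (hd x (Set.Ico_subset_Icc_self hx)).hasDerivWithinAt) (by simp)
    (fun x hx => (hB' x hx).continuousAt.continuousWithinAt)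
    (fun x hx => (hB' x (Set.Ico_subset_Icc_self hx)).hasDerivWithinAt) ?_
    (Set.right_mem_Icc.2 hst)
  intro x hx
  have hx' := hmem x (Set.Ico_subset_Icc_self hx)
  have := f.norm_deriv_le hα hx'.1
  rw [hx'.2] at this
  rwa [norm_mul, hζ, mul_one]

end Bloch

theorem exists_unit_mul (z : ℂ) : ∃ ζ : ℂ, ‖ζ‖ = 1 ∧ z = (‖z‖ : ℂ) * ζ := by
  by_cases hz : z = 0
  · exact ⟨1, by simp, by simp [hz]⟩
  · have : (‖z‖ : ℂ) ≠ 0 := by simpa using hz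
    exact ⟨z / ‖z‖, by simp [hz], by field_simp⟩

theorem hasDerivAt_radial_log {x : ℝ} (hx : x < 1) :
    HasDerivAt (fun x => -Real.log (1 - x)) ((1 - x) ^ (-(1 : ℝ))) x := by
  have h0 : 1 - x ≠ 0 := by linarith
  have := (((hasDerivAt_id x).const_sub 1).log h0).neg
  rw [Real.rpow_neg_one]
  convert! this using 1
  simp [neg_div]

theorem hasDerivAt_radial_rpow {α x : ℝ} (hα : α ≠ 1) (hx : x < 1) :
    HasDerivAt (fun x => (1 - x) ^ (1 - α) / (α - 1)) ((1 - x) ^ (-α)) x := by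
  have h0 : 1 - x ≠ 0 := by linarith
  have h1 : α - 1 ≠ 0 := sub_ne_zero.2 hα
  have := (((hasDerivAt_id x).const_sub 1).rpow_const (p := 1 - α) (Or.inl h0)).div_const (α - 1)
  convert! this using 1
  rw [show 1 - α - 1 = -α by ring]
  field_simp
  simp only [id]
  ring

namespace Bloch

variable {α : ℝ}

theorem norm_apply_le_of_eq_one (f : Bloch 1) {z : ℂ} (hz : z ∈ disk) :
    ‖f.toFun z‖ ≤ ‖f‖ * (1 - Real.log (1 - ‖z‖)) := by
  obtain ⟨ζ, hζ, hzζ⟩ := exists_unit_mul z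
  have := f.norm_apply_radial_le one_pos hζ (fun x hx => hasDerivAt_radial_log hx.2) le_rfl
    (norm_nonneg z) (norm_lt_one hz)
  rw [← hzζ] at this
  simp only [Complex.ofReal_zero, zero_mul, sub_zero, Real.log_one, neg_zero] at this
  linarith [f.norm_apply_zero_le]

theorem norm_apply_le_of_one_lt (hα : 1 < α) (f : Bloch α) {z : ℂ} (hz : z ∈ disk) :
    ‖f.toFun z‖ ≤ ‖f‖ * (1 + (1 - ‖z‖) ^ (1 - α) / (α - 1)) := by
  obtain ⟨ζ, hζ, hzζ⟩ := exists_unit_mul z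
  have := f.norm_apply_radial_le (by linarith) hζ (fun x hx => hasDerivAt_radial_rpow hα.ne' hx.2)
    le_rfl (norm_nonneg z) (norm_lt_one hz)
  rw [← hzζ] at this
  simp only [Complex.ofReal_zero, zero_mul, sub_zero, Real.one_rpow] at this
  have h1 : 0 < 1 / (α - 1) := by apply one_div_pos.2; linarith
  nlinarith [f.norm_apply_zero_le, norm_nonneg f]

/-- For `α < 1` the antiderivative stays finite at 1, so the error of moving inward to radius `r`
tends to 0 as `r → 1`, uniformly in `z`. -/
theorem norm_apply_le_of_lt_one (hα : 0 < α) (hα1 : α < 1) (f : Bloch α) {z : ℂ} (hz : z ∈ disk)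
    {r : ℝ} (hr : 0 ≤ r) (hrz : r ≤ ‖z‖) :
    ∃ w : ℂ, ‖w‖ = r ∧ ‖f.toFun z‖ ≤ ‖f.toFun w‖ + ‖f‖ * ((1 - r) ^ (1 - α) / (1 - α)) := by
  obtain ⟨ζ, hζ, hzζ⟩ := exists_unit_mul z
  have := f.norm_apply_radial_le hα hζ (fun x hx => hasDerivAt_radial_rpow hα1.ne hx.2) hr hrz
    (norm_lt_one hz)
  rw [← hzζ] at this
  refine ⟨r * ζ, by simp [hζ, abs_of_nonneg hr], this.trans ?_⟩
  gcongr
  have h1 : 0 ≤ (1 - ‖z‖) ^ (1 - α) / (1 - α) :=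
    div_nonneg (Real.rpow_nonneg (by linarith [norm_lt_one hz]) _) (by linarith)
  have h2 : ∀ x : ℝ, x / (α - 1) = -(x / (1 - α)) := fun x => by
    rw [← neg_sub 1 α, div_neg]
  rw [h2, h2]
  linarith

end Bloch

/-! ### Continuity of point evaluations on the Zygmund type space. -/

namespace Zygmund

variable {β : ℝ}

theorem weight_mul_deriv_deriv_le (f : Zygmund β) {z : ℂ} (hz : z ∈ disk) :
    (1 - ‖z‖ ^ 2) ^ β * ‖deriv (deriv f.toFun) z‖ ≤ ‖f‖ := by
  have := le_weightedSup f.mem.2 hz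
  rw [Zygmund.norm_def]
  linarith [norm_nonneg (f.toFun 0), norm_nonneg (deriv f.toFun 0)]

theorem norm_le {f : Zygmund β} {a b c : ℝ} (h0 : ‖f.toFun 0‖ ≤ a) (h1 : ‖deriv f.toFun 0‖ ≤ b)
    (hc : 0 ≤ c) (h2 : ∀ z ∈ disk, (1 - ‖z‖ ^ 2) ^ β * ‖deriv (deriv f.toFun) z‖ ≤ c) :
    ‖f‖ ≤ a + b + c := by
  have := weightedSup_toReal_le hc h2
  rw [Zygmund.norm_def]
  linarith

/-- Integrating the bound on `f''` twice over the closed ball of radius `‖z‖` bounds evaluation at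
`z`. This identifies norm limits with pointwise limits. -/
theorem exists_norm_apply_le (hβ : 0 < β) {z : ℂ} (hz : z ∈ disk) :
    ∃ C, ∀ f : Zygmund β, ‖f.toFun z‖ ≤ C * ‖f‖ := by
  have hr := norm_lt_one hz
  set r := ‖z‖ with hr_def
  have hr0 : 0 ≤ r := norm_nonneg z
  have hw : 0 < (1 - r ^ 2) ^ β := weight_pos' β hz
  set D := ((1 - r ^ 2) ^ β)⁻¹ with hD
  have hD0 : 0 < D := inv_pos.2 hw
  refine ⟨2 + D, fun f => ?_⟩
  have hsub : ∀ w ∈ Metric.closedBall (0 : ℂ) r, ‖w‖ ≤ r := fun w hw => by simpa using hw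
  have hdisk : ∀ w ∈ Metric.closedBall (0 : ℂ) r, w ∈ disk := fun w hw =>
    mem_disk ((hsub w hw).trans_lt hr)
  have e0 : ‖f.toFun 0‖ ≤ ‖f‖ := by
    rw [Zygmund.norm_def]
    linarith [norm_nonneg (deriv f.toFun 0),
      ENNReal.toReal_nonneg (a := weightedSup β (deriv (deriv f.toFun)))]
  have e1 : ‖deriv f.toFun 0‖ ≤ ‖f‖ := by
    rw [Zygmund.norm_def]
    linarith [norm_nonneg (f.toFun 0),
      ENNReal.toReal_nonneg (a := weightedSup β (deriv (deriv f.toFun)))]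
  have h2 : ∀ w ∈ Metric.closedBall (0 : ℂ) r, ‖deriv (deriv f.toFun) w‖ ≤ D * ‖f‖ := by
    intro w hw'
    have h3 := f.weight_mul_deriv_deriv_le (hdisk w hw')
    have h4 : (1 - r ^ 2) ^ β ≤ (1 - ‖w‖ ^ 2) ^ β := by
      apply Real.rpow_le_rpow (by nlinarith) _ hβ.le
      have := hsub w hw'
      gcongr
    rw [hD, inv_mul_eq_div, le_div_iff₀ hw]
    nlinarith [norm_nonneg (deriv (deriv f.toFun) w)]
  have h0mem : (0 : ℂ) ∈ Metric.closedBall (0 : ℂ) r := Metric.mem_closedBall_self hr0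
  have hbound : ∀ {F : ℂ → ℂ} {M : ℝ}, (∀ w ∈ disk, DifferentiableAt ℂ F w) → 0 ≤ M →
      (∀ w ∈ Metric.closedBall (0 : ℂ) r, ‖deriv F w‖ ≤ M) →
      ∀ w ∈ Metric.closedBall (0 : ℂ) r, ‖F w‖ ≤ ‖F 0‖ + M := by
    intro F M hF hM hF' w hw'
    have := (convex_closedBall (0 : ℂ) r).norm_image_sub_le_of_norm_deriv_le
      (fun x hx => hF x (hdisk x hx)) hF' h0mem hw'
    have h5 := norm_le_norm_add_norm_sub' (F w) (F 0)
    have h6 : M * ‖w - 0‖ ≤ M := by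
      rw [sub_zero]
      nlinarith [hsub w hw']
    linarith
  have h1 := hbound (fun w hw => holo_diff_deriv f.mem.1 hw) (by positivity) h2
  have h3 := hbound (M := ‖f‖ + D * ‖f‖) (fun w hw => holo_diff f.mem.1 hw) (by positivity)
    (fun w hw => by linarith [h1 w hw]) z (by simp [hr_def])
  linarith

end Zygmund

theorem deriv_deriv_weightedComp {u φ f g : ℂ → ℂ} (hu : DifferentiableOn ℂ u disk)
    (hφ : DifferentiableOn ℂ φ disk) (hφm : Set.MapsTo φ disk disk)
    (hf : DifferentiableOn ℂ f disk) (hg : ∀ z ∈ disk, g z = u z * f (φ z)) {z : ℂ}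
    (hz : z ∈ disk) :
    deriv g z = deriv u z * f (φ z) + u z * (deriv f (φ z) * deriv φ z) ∧
    deriv (deriv g) z = deriv (deriv u) z * f (φ z)
      + (2 * deriv u z * deriv φ z + u z * deriv (deriv φ) z) * deriv f (φ z)
      + u z * deriv φ z ^ 2 * deriv (deriv f) (φ z) := by
  have hd : ∀ {F : ℂ → ℂ}, DifferentiableOn ℂ F disk → ∀ w ∈ disk, HasDerivAt F (deriv F w) w :=
    fun hF w hw => (hF.differentiableAt (Metric.isOpen_ball.mem_nhds hw)).hasDerivAt
  have hfφ : ∀ w ∈ disk, HasDerivAt (fun w => f (φ w)) (deriv f (φ w) * deriv φ w) w :=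
    fun w hw => (hd hf _ (hφm hw)).comp w (hd hφ w hw)
  have h1 : ∀ w ∈ disk, deriv g w
      = deriv u w * f (φ w) + u w * (deriv f (φ w) * deriv φ w) := by
    intro w hw
    have he : g =ᶠ[𝓝 w] fun w => u w * f (φ w) := by
      filter_upwards [Metric.isOpen_ball.mem_nhds hw] with x hx using hg x hx
    rw [he.deriv_eq]
    exact ((hd hu w hw).mul (hfφ w hw)).deriv
  refine ⟨h1 z hz, ?_⟩
  have he : deriv g =ᶠ[𝓝 z]
      fun w => deriv u w * f (φ w) + u w * (deriv f (φ w) * deriv φ w) := by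
    filter_upwards [Metric.isOpen_ball.mem_nhds hz] with x hx using h1 x hx
  rw [he.deriv_eq]
  have hu' := hd (hu.deriv Metric.isOpen_ball) z hz
  have hφ' := hd (hφ.deriv Metric.isOpen_ball) z hz
  have hf' : HasDerivAt (fun w => deriv f (φ w)) (deriv (deriv f) (φ z) * deriv φ z) z :=
    (hd (hf.deriv Metric.isOpen_ball) _ (hφm hz)).comp z (hd hφ z hz)
  refine ((hu'.mul (hfφ z hz)).add ((hd hu z hz).mul (hf'.mul hφ'))).deriv.trans ?_
  simp only [Pi.mul_apply]
  ring

/-! ### Normal families in the Bloch type space. -/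

namespace Bloch

variable {α : ℝ}

theorem toFun_sub (f g : Bloch α) : (f - g).toFun = f.toFun - g.toFun := rfl

/-- The element of `𝓑^α` given by a function analytic on the disk, whatever its values outside. -/
def ofFun (f : ℂ → ℂ) (hf : DifferentiableOn ℂ f disk) (h : weightedSup α (deriv f) < ∞) :
    Bloch α :=
  ⟨disk.indicator f, ⟨hf.congr fun _ hz => Set.indicator_of_mem hz f,
    fun _ hz => Set.indicator_of_notMem hz f⟩, by
    refine (weightedSup_congr fun z hz => ?_).trans_lt h
    exact (Set.eqOn_indicator.eventuallyEq_of_mem (Metric.isOpen_ball.mem_nhds hz)).deriv_eq⟩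

variable {f : ℂ → ℂ} {hf : DifferentiableOn ℂ f disk} {h : weightedSup α (deriv f) < ∞}

theorem ofFun_apply {z : ℂ} (hz : z ∈ disk) : (ofFun f hf h).toFun z = f z :=
  Set.indicator_of_mem hz f

theorem deriv_ofFun {z : ℂ} (hz : z ∈ disk) : deriv (ofFun f hf h).toFun z = deriv f z :=
  (Set.eqOn_indicator.eventuallyEq_of_mem (Metric.isOpen_ball.mem_nhds hz)).deriv_eq

theorem deriv_deriv_ofFun {z : ℂ} (hz : z ∈ disk) :
    deriv (deriv (ofFun f hf h).toFun) z = deriv (deriv f) z := by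
  refine Filter.EventuallyEq.deriv_eq ?_
  filter_upwards [Metric.isOpen_ball.mem_nhds hz] with w hw using deriv_ofFun hw

theorem norm_ofFun_le {C : ℝ} (hC : 0 ≤ C)
    (hb : ∀ z ∈ disk, (1 - ‖z‖ ^ 2) ^ α * ‖deriv f z‖ ≤ C) : ‖ofFun f hf h‖ ≤ ‖f 0‖ + C := by
  rw [Bloch.norm_def, ofFun_apply zero_mem_disk]
  gcongr
  exact weightedSup_toReal_le hC fun z hz => by rw [deriv_ofFun hz]; exact hb z hz

theorem norm_apply_sub_apply_le (hα : 0 < α) (f : Bloch α) {r : ℝ} (hr : r < 1) {z w : ℂ}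
    (hz : ‖z‖ ≤ r) (hw : ‖w‖ ≤ r) :
    ‖f.toFun z - f.toFun w‖ ≤ ‖f‖ * (1 - r) ^ (-α) * ‖z - w‖ := by
  have hsub : ∀ x ∈ Metric.closedBall (0 : ℂ) r, x ∈ disk ∧ ‖x‖ ≤ r := fun x hx => by
    rw [mem_closedBall_zero_iff] at hx
    exact ⟨mem_disk (hx.trans_lt hr), hx⟩
  refine (convex_closedBall (0 : ℂ) r).norm_image_sub_le_of_norm_deriv_le
    (fun x hx => holo_diff f.mem.1 (hsub x hx).1) (fun x hx => ?_) (by simpa using hw)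
    (by simpa using hz)
  refine (f.norm_deriv_le hα (hsub x hx).1).trans ?_
  refine mul_le_mul_of_nonneg_left ?_ (norm_nonneg f)
  exact Real.rpow_le_rpow_of_nonpos (by linarith) (by linarith [(hsub x hx).2]) (by linarith)

/-- A Montel argument: values at a point lie in a compact disc, so they converge along the
ultrafilter, and the common Lipschitz constant on smaller discs makes the convergence locally
uniform. -/
theorem exists_tendstoLocallyUniformlyOn (hα : 0 < α) {ι : Type*} (U : Ultrafilter ι)
    (F : ι → Bloch α) (hF : ∀ i, ‖F i‖ ≤ 1) :
    ∃ g : Bloch α, ‖g‖ ≤ 1 ∧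
      TendstoLocallyUniformlyOn (fun i => (F i).toFun) g.toFun U disk := by
  have hlim : ∀ z ∈ disk, ∃ y, Tendsto (fun i => (F i).toFun z) U (𝓝 y) := by
    intro z hz
    have hb : ∀ i, (F i).toFun z ∈ Metric.closedBall (0 : ℂ) (1 + (1 - ‖z‖) ^ (-α) * ‖z‖) := by
      intro i
      rw [mem_closedBall_zero_iff]
      have h1 := (F i).norm_apply_sub_apply_le hα (norm_lt_one hz) le_rfl
        (w := 0) (by simp)
      have h2 := norm_le_norm_add_norm_sub' ((F i).toFun z) ((F i).toFun 0)
      have h3 := (F i).norm_apply_zero_le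
      have h4 : 0 ≤ (1 - ‖z‖) ^ (-α) := Real.rpow_nonneg (by linarith [norm_lt_one hz]) _
      have h5 : ‖F i‖ * (1 - ‖z‖) ^ (-α) * ‖z - 0‖ ≤ 1 * (1 - ‖z‖) ^ (-α) * ‖z‖ := by
        rw [sub_zero]
        gcongr
        exact hF i
      linarith [hF i]
    obtain ⟨y, -, hy⟩ := (isCompact_closedBall (0 : ℂ) _).ultrafilter_le_nhds
      (U.map fun i => (F i).toFun z) (by
        rw [le_principal_iff]
        exact Filter.mem_map.2 (Filter.univ_mem' hb))
    exact ⟨y, hy⟩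
  choose! g hg using hlim
  have hgL : ∀ {r : ℝ}, r < 1 → ∀ z w : ℂ, ‖z‖ ≤ r → ‖w‖ ≤ r →
      ‖g z - g w‖ ≤ (1 - r) ^ (-α) * ‖z - w‖ := by
    intro r hr z w hz hw
    refine le_of_tendsto ((hg z (mem_disk (hz.trans_lt hr))).sub
      (hg w (mem_disk (hw.trans_lt hr)))).norm (Eventually.of_forall fun i => ?_)
    refine ((F i).norm_apply_sub_apply_le hα hr hz hw).trans ?_
    have h4 : 0 ≤ (1 - r) ^ (-α) := Real.rpow_nonneg (by linarith) _
    refine mul_le_mul_of_nonneg_right ?_ (norm_nonneg _)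
    nlinarith [hF i]
  have hloc : TendstoLocallyUniformlyOn (fun i => (F i).toFun) g U disk := by
    rw [Metric.tendstoLocallyUniformlyOn_iff]
    intro ε hε x hx
    have hx1 := norm_lt_one hx
    set r := (1 + ‖x‖) / 2 with hr_def
    have hr : r < 1 := by linarith
    set L := (1 - r) ^ (-α) with hL
    have hL0 : 0 < L := Real.rpow_pos_of_pos (by linarith) _
    refine ⟨Metric.ball x (min ((1 - ‖x‖) / 2) (ε / (3 * L))),
      mem_nhdsWithin_of_mem_nhds (Metric.ball_mem_nhds _ (lt_min (by linarith) (by positivity))), ?_⟩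
    filter_upwards [(Metric.tendsto_nhds.1 (hg x hx)) (ε / 3) (by positivity)] with i hi y hy
    rw [Metric.mem_ball, dist_eq_norm, lt_min_iff] at hy
    have hyL := (lt_div_iff₀ (by positivity)).1 hy.2
    have hyr : ‖y‖ ≤ r := by
      have := norm_le_norm_add_norm_sub' y x
      linarith [hy.1]
    have hxr : ‖x‖ ≤ r := by linarith
    have h1 := hgL hr y x hyr hxr
    have h2 := (F i).norm_apply_sub_apply_le hα hr hyr hxr
    have h3 : ‖F i‖ * L * ‖y - x‖ ≤ L * ‖y - x‖ := by
      refine mul_le_mul_of_nonneg_right ?_ (norm_nonneg _)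
      nlinarith [hF i]
    rw [← hL] at h1 h2
    rw [dist_eq_norm] at hi ⊢
    have h4 : g y - (F i).toFun y = (g y - g x) - ((F i).toFun y - (F i).toFun x)
        - ((F i).toFun x - g x) := by ring
    rw [h4]
    have h5 := norm_sub_le ((g y - g x) - ((F i).toFun y - (F i).toFun x)) ((F i).toFun x - g x)
    have h6 := norm_sub_le (g y - g x) ((F i).toFun y - (F i).toFun x)
    linarith
  have hFd : ∀ᶠ i in (U : Filter ι), DifferentiableOn ℂ (F i).toFun disk :=
    Eventually.of_forall fun i => (F i).mem.1.1
  have hgd : DifferentiableOn ℂ g disk := hloc.differentiableOn hFd Metric.isOpen_ball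
  have hderiv := hloc.deriv hFd Metric.isOpen_ball
  -- Keeping `‖g 0‖` in the bound, instead of estimating the two parts of the norm separately, is
  -- what leaves `g` in the unit ball.
  have hle : ∀ z ∈ disk, (1 - ‖z‖ ^ 2) ^ α * ‖deriv g z‖ ≤ 1 - ‖g 0‖ := by
    intro z hz
    have h1 := ((hderiv.tendsto_at hz).norm.const_mul ((1 - ‖z‖ ^ 2) ^ α)).add
      (hg 0 zero_mem_disk).norm
    have h2 := le_of_tendsto h1 (b := 1) (Eventually.of_forall fun i => by
      have h3 := le_weightedSup (F i).mem.2 hz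
      have h4 := hF i
      rw [Bloch.norm_def] at h4
      simp only [Function.comp]
      linarith)
    linarith
  have h01 : 0 ≤ 1 - ‖g 0‖ :=
    (mul_nonneg (weight_pos' α zero_mem_disk).le (norm_nonneg _)).trans (hle 0 zero_mem_disk)
  refine ⟨ofFun g hgd ((weightedSup_le hle).trans_lt ENNReal.ofReal_lt_top), ?_, ?_⟩
  · exact (norm_ofFun_le h01 hle).trans_eq (by ring)
  · exact hloc.congr_right fun z hz => (ofFun_apply hz).symm

theorem eventually_norm_le {ι : Type*} {l : Filter ι} {H : ι → Bloch α}
    (hH : TendstoLocallyUniformlyOn (fun i => (H i).toFun) 0 l disk) {r : ℝ} (hr : r < 1)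
    {ε : ℝ} (hε : 0 < ε) :
    ∀ᶠ i in l, ∀ z : ℂ, ‖z‖ ≤ r → ‖(H i).toFun z‖ ≤ ε ∧ ‖deriv (H i).toFun z‖ ≤ ε ∧
      ‖deriv (deriv (H i).toFun) z‖ ≤ ε := by
  have h0 : deriv (0 : ℂ → ℂ) = 0 := by
    funext z
    simp [Pi.zero_def]
  have hd : ∀ᶠ i in l, DifferentiableOn ℂ (H i).toFun disk :=
    Eventually.of_forall fun i => (H i).mem.1.1
  have h1 := hH.deriv hd Metric.isOpen_ball
  have h2 := h1.deriv (hd.mono fun i hi => hi.deriv Metric.isOpen_ball) Metric.isOpen_ball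
  rw [h0] at h1 h2
  rw [h0] at h2
  have hsub : Metric.closedBall (0 : ℂ) r ⊆ disk := Metric.closedBall_subset_ball hr
  have key : ∀ {F : ι → ℂ → ℂ}, TendstoLocallyUniformlyOn F 0 l disk →
      ∀ᶠ i in l, ∀ z : ℂ, ‖z‖ ≤ r → ‖F i z‖ ≤ ε := by
    intro F hF
    have h3 := (tendstoLocallyUniformlyOn_iff_forall_isCompact Metric.isOpen_ball).1 hF _ hsub
      (isCompact_closedBall _ _)
    filter_upwards [Metric.tendstoUniformlyOn_iff.1 h3 ε hε] with i hi z hz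
    simpa using (hi z (by simpa using hz)).le
  filter_upwards [key hH, key h1, key h2] with i a b c z hz using ⟨a z hz, b z hz, c z hz⟩

end Bloch

/-! ### From limsup conditions to estimates as `|φ z| → 1`. -/

theorem exists_nat_of_tendsto {β : ℝ} {G φ : ℂ → ℂ} (hφm : Set.MapsTo φ disk disk) {c : ℕ → ℝ}
    (hc : ∀ n, 0 ≤ c n)
    (h : limsup (fun n => ENNReal.ofReal (c n) * weightedSup β (fun z => G z * φ z ^ n)) atTop = 0)
    (N : ℕ) {ε : ℝ} (hε : 0 < ε) :
    ∃ r < 1, ∀ z ∈ disk, r ≤ ‖φ z‖ → ∃ n, N ≤ n ∧ (1 - ‖φ z‖)⁻¹ ≤ 2 * (n + 1) ∧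
      (1 - ‖z‖ ^ 2) ^ β * ‖G z‖ * c n ≤ ε := by
  have ht : ∀ᶠ n in atTop, ENNReal.ofReal (c n) * weightedSup β (fun z => G z * φ z ^ n)
      < ENNReal.ofReal (ε / 2) :=
    eventually_lt_of_limsup_lt (by rw [h]; simpa using hε)
  obtain ⟨N', hN'⟩ := eventually_atTop.1 ht
  set M := max N N' with hM
  -- This radius makes `1/(2(1-‖φ z‖)) ≥ M`, so the floor chosen below as exponent is beyond both
  -- thresholds.
  refine ⟨1 - 1 / (2 * (M + 1)), by linarith [show (0 : ℝ) < 1 / (2 * (M + 1)) by positivity],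
    fun z hz hr => ?_⟩
  have hx : 0 < 1 - ‖φ z‖ := by linarith [norm_lt_one (hφm hz)]
  set x := ‖φ z‖ with hx_def
  have hMx : (M : ℝ) ≤ (2 * (1 - x))⁻¹ := by
    have h1 : 1 - x ≤ 1 / (2 * (M + 1)) := by linarith
    rw [le_div_iff₀ (by positivity)] at h1
    rw [← one_div, le_div_iff₀ (by positivity)]
    nlinarith
  set n := ⌊(2 * (1 - x))⁻¹⌋₊ with hn
  have hMn : M ≤ n := Nat.le_floor hMx
  have hnx : (n : ℝ) ≤ (2 * (1 - x))⁻¹ := Nat.floor_le (by positivity)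
  have hnx' : (2 * (1 - x))⁻¹ < n + 1 := Nat.lt_floor_add_one _
  refine ⟨n, (le_max_left _ _).trans hMn, ?_, ?_⟩
  · rw [mul_inv] at hnx'
    linarith
  · have h2 := hN' n ((le_max_right _ _).trans hMn)
    have h3 : ENNReal.ofReal ((1 - ‖z‖ ^ 2) ^ β * ‖G z * φ z ^ n‖)
        ≤ weightedSup β (fun z => G z * φ z ^ n) :=
      le_iSup (fun z : disk => ENNReal.ofReal ((1 - ‖(z : ℂ)‖ ^ 2) ^ β * ‖G z * φ z ^ n‖)) ⟨z, hz⟩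
    have h4 : ENNReal.ofReal (c n * ((1 - ‖z‖ ^ 2) ^ β * ‖G z * φ z ^ n‖))
        ≤ ENNReal.ofReal (ε / 2) := by
      rw [ENNReal.ofReal_mul (hc n)]
      exact (mul_le_mul_right h3 _).trans h2.le
    rw [ENNReal.ofReal_le_ofReal_iff (by positivity), norm_mul, norm_pow, ← hx_def] at h4
    -- Bernoulli's inequality with `n(1-x) ≤ 1/2`; the loss of a factor 2 is paid by the `ε / 2`
    -- above.
    have h5 : 1 / 2 ≤ x ^ n := by
      have h6 := one_add_mul_le_pow (a := -(1 - x)) (by linarith [norm_nonneg (φ z)]) n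
      have h7 : n * (1 - x) ≤ 1 / 2 := by
        calc n * (1 - x) ≤ (2 * (1 - x))⁻¹ * (1 - x) := by gcongr
          _ = 1 / 2 := by field_simp
      have h8 : 1 + -(1 - x) = x := by ring
      rw [h8] at h6
      linarith
    have h9 : 0 ≤ (1 - ‖z‖ ^ 2) ^ β * ‖G z‖ * c n :=
      mul_nonneg (mul_nonneg (weight_pos' β hz).le (norm_nonneg _)) (hc n)
    nlinarith

theorem exists_boundary_rpow_le {β γ : ℝ} (hγ : 0 ≤ γ) {G φ : ℂ → ℂ}
    (hφm : Set.MapsTo φ disk disk)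
    (h : limsup (fun n : ℕ => ENNReal.ofReal (((n : ℝ) + 1) ^ γ) *
      weightedSup β (fun z => G z * φ z ^ n)) atTop = 0) {ε : ℝ} (hε : 0 < ε) :
    ∃ r < 1, ∀ z ∈ disk, r ≤ ‖φ z‖ →
      (1 - ‖z‖ ^ 2) ^ β * ‖G z‖ * (1 - ‖φ z‖) ^ (-γ) ≤ ε := by
  obtain ⟨r, hr, H⟩ := exists_nat_of_tendsto hφm (fun n => by positivity) h 0
    (ε := ε / 2 ^ γ) (by positivity)
  refine ⟨r, hr, fun z hz hrz => ?_⟩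
  obtain ⟨n, -, h1, h2⟩ := H z hz hrz
  have hx : 0 < 1 - ‖φ z‖ := by linarith [norm_lt_one (hφm hz)]
  have h3 : (1 - ‖φ z‖) ^ (-γ) ≤ 2 ^ γ * ((n : ℝ) + 1) ^ γ := by
    rw [Real.rpow_neg hx.le, ← Real.inv_rpow hx.le, ← Real.mul_rpow (by norm_num) (by positivity)]
    exact Real.rpow_le_rpow (by positivity) h1 hγ
  have h4 := weight_pos' β hz
  calc (1 - ‖z‖ ^ 2) ^ β * ‖G z‖ * (1 - ‖φ z‖) ^ (-γ)
      ≤ (1 - ‖z‖ ^ 2) ^ β * ‖G z‖ * (2 ^ γ * ((n : ℝ) + 1) ^ γ) := by gcongr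
    _ = 2 ^ γ * ((1 - ‖z‖ ^ 2) ^ β * ‖G z‖ * ((n : ℝ) + 1) ^ γ) := by ring
    _ ≤ 2 ^ γ * (ε / 2 ^ γ) := by gcongr
    _ = ε := by field_simp

theorem exists_boundary_log_le {β : ℝ} {G φ : ℂ → ℂ} (hφm : Set.MapsTo φ disk disk)
    (h : limsup (fun n : ℕ => ENNReal.ofReal (Real.log n) *
      weightedSup β (fun z => G z * φ z ^ n)) atTop = 0) {ε : ℝ} (hε : 0 < ε) :
    ∃ r < 1, ∀ z ∈ disk, r ≤ ‖φ z‖ →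
      (1 - ‖z‖ ^ 2) ^ β * ‖G z‖ * (1 - Real.log (1 - ‖φ z‖)) ≤ ε := by
  -- For `n ≥ 3`, `log n ≥ 1` and `2(n+1) ≤ n³`; hence `1 - log(1-‖φ z‖) ≤ 4 log n`, which explains
  -- `ε / 4`.
  obtain ⟨r, hr, H⟩ := exists_nat_of_tendsto hφm (fun n => Real.log_natCast_nonneg n) h 3
    (ε := ε / 4) (by positivity)
  refine ⟨r, hr, fun z hz hrz => ?_⟩
  obtain ⟨n, hn, h1, h2⟩ := H z hz hrz
  have hx : 0 < 1 - ‖φ z‖ := by linarith [norm_lt_one (hφm hz)]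
  have hn' : (3 : ℝ) ≤ n := by exact_mod_cast hn
  have e1 : 1 ≤ Real.log n := by
    rw [Real.le_log_iff_exp_le (by linarith)]
    linarith [Real.exp_one_lt_d9]
  have e2 : Real.log ((1 - ‖φ z‖)⁻¹) ≤ 3 * Real.log n := by
    rw [show (3 : ℝ) * Real.log n = Real.log ((n : ℝ) ^ 3) by simp]
    refine Real.log_le_log (by positivity) (h1.trans ?_)
    nlinarith [mul_nonneg (sub_nonneg.2 hn') (sub_nonneg.2 hn'),
      mul_nonneg (mul_nonneg (sub_nonneg.2 hn') (sub_nonneg.2 hn')) (sub_nonneg.2 hn')]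
  rw [Real.log_inv] at e2
  have h4 := weight_pos' β hz
  have h5 : 0 ≤ (1 - ‖z‖ ^ 2) ^ β * ‖G z‖ := by positivity
  calc (1 - ‖z‖ ^ 2) ^ β * ‖G z‖ * (1 - Real.log (1 - ‖φ z‖))
      ≤ (1 - ‖z‖ ^ 2) ^ β * ‖G z‖ * (4 * Real.log n) :=
        mul_le_mul_of_nonneg_left (by linarith) h5
    _ ≤ ε := by linarith

theorem exists_boundary_apply_le {α β : ℝ} (hα : 0 < α) {X φ : ℂ → ℂ}
    (hφm : Set.MapsTo φ disk disk) {M : ℝ} (hM : 0 ≤ M)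
    (hXM : ∀ z ∈ disk, (1 - ‖z‖ ^ 2) ^ β * ‖X z‖ ≤ M)
    (h1 : α = 1 → limsup (fun n : ℕ => ENNReal.ofReal (Real.log n) *
      weightedSup β (fun z => X z * φ z ^ n)) atTop = 0)
    (h2 : 1 < α → limsup (fun n : ℕ => ENNReal.ofReal (((n : ℝ) + 1) ^ (α - 1)) *
      weightedSup β (fun z => X z * φ z ^ n)) atTop = 0)
    {ι : Type*} {l : Filter ι} {H : ι → Bloch α} (hH2 : ∀ i, ‖H i‖ ≤ 2)
    (hH : TendstoLocallyUniformlyOn (fun i => (H i).toFun) 0 l disk) {ε : ℝ} (hε : 0 < ε) :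
    ∃ r < 1, ∀ᶠ i in l, ∀ z ∈ disk, r ≤ ‖φ z‖ →
      (1 - ‖z‖ ^ 2) ^ β * ‖X z‖ * ‖(H i).toFun (φ z)‖ ≤ ε := by
  have hw0 : ∀ z ∈ disk, 0 ≤ (1 - ‖z‖ ^ 2) ^ β * ‖X z‖ := fun z hz =>
    mul_nonneg (weight_pos' β hz).le (norm_nonneg _)
  rcases lt_trichotomy α 1 with hlt | rfl | hgt
  -- For `α < 1` the radius is chosen so that radial variation beyond it is negligible; convergence
  -- on the circle of radius `r` does the rest.
  · have ht : Tendsto (fun r : ℝ => 2 * ((1 - r) ^ (1 - α) / (1 - α))) (𝓝[<] 1) (𝓝 0) := by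
      have hc : ContinuousAt (fun r : ℝ => 2 * ((1 - r) ^ (1 - α) / (1 - α))) 1 := by
        refine ((ContinuousAt.rpow_const (by fun_prop) (Or.inr ?_)).div_const _).const_mul _
        linarith
      have h0 := hc.tendsto
      simp only [sub_self] at h0
      rw [Real.zero_rpow (by linarith)] at h0
      simp only [zero_div, mul_zero] at h0
      exact h0.mono_left nhdsWithin_le_nhds
    have hη : 0 < ε / (2 * (M + 1)) := by positivity
    obtain ⟨r, hr, hr0, hr1⟩ := ((ht.eventually_lt_const hη).and
      (Ioo_mem_nhdsLT (show (0 : ℝ) < 1 by norm_num))).exists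
    refine ⟨r, hr1, ?_⟩
    filter_upwards [Bloch.eventually_norm_le hH hr1 hη] with i hi z hz hrz
    obtain ⟨w, hw, hle⟩ := (H i).norm_apply_le_of_lt_one hα hlt (hφm hz) hr0.le hrz
    have h3 := (hi w hw.le).1
    have h4 : 0 ≤ (1 - r) ^ (1 - α) / (1 - α) :=
      div_nonneg (Real.rpow_nonneg (by linarith) _) (by linarith)
    have h5 : ‖(H i).toFun (φ z)‖ ≤ ε / (M + 1) := by
      have : ε / (M + 1) = ε / (2 * (M + 1)) + ε / (2 * (M + 1)) := by field_simp; ring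
      nlinarith [hH2 i]
    calc (1 - ‖z‖ ^ 2) ^ β * ‖X z‖ * ‖(H i).toFun (φ z)‖ ≤ (M + 1) * (ε / (M + 1)) :=
          mul_le_mul (by linarith [hXM z hz]) h5 (norm_nonneg _) (by linarith)
      _ = ε := by field_simp
  · obtain ⟨r, hr, h⟩ := exists_boundary_log_le hφm (h1 rfl) (half_pos hε)
    refine ⟨r, hr, Eventually.of_forall fun i z hz hrz => ?_⟩
    have h3 := h z hz hrz
    have h4 := (H i).norm_apply_le_of_eq_one (hφm hz)
    have h5 : 0 ≤ 1 - Real.log (1 - ‖φ z‖) := by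
      have := Real.log_nonpos (x := 1 - ‖φ z‖) (by linarith [norm_lt_one (hφm hz)])
        (by linarith [norm_nonneg (φ z)])
      linarith
    have h6 : ‖(H i).toFun (φ z)‖ ≤ 2 * (1 - Real.log (1 - ‖φ z‖)) := by
      nlinarith [hH2 i]
    have := mul_le_mul_of_nonneg_left h6 (hw0 z hz)
    linarith
  · set K := 2 * (1 + 1 / (α - 1)) with hK
    have hα1 : 0 < α - 1 := by linarith
    have hK0 : 0 < K := by positivity
    obtain ⟨r, hr, h⟩ := exists_boundary_rpow_le hα1.le hφm (h2 hgt)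
      (ε := ε / K) (by positivity)
    refine ⟨r, hr, Eventually.of_forall fun i z hz hrz => ?_⟩
    have h3 := h z hz hrz
    rw [neg_sub] at h3
    have h4 := (H i).norm_apply_le_of_one_lt hgt (hφm hz)
    have h5 : 1 ≤ (1 - ‖φ z‖) ^ (1 - α) :=
      Real.one_le_rpow_of_pos_of_le_one_of_nonpos (by linarith [norm_lt_one (hφm hz)])
        (by linarith [norm_nonneg (φ z)]) (by linarith)
    have h6 : ‖(H i).toFun (φ z)‖ ≤ K * (1 - ‖φ z‖) ^ (1 - α) := by
      have h7 : (1 - ‖φ z‖) ^ (1 - α) / (α - 1) = 1 / (α - 1) * (1 - ‖φ z‖) ^ (1 - α) := by ring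
      have h8 : 0 ≤ 1 + (1 - ‖φ z‖) ^ (1 - α) / (α - 1) := by positivity
      rw [hK]
      nlinarith [hH2 i]
    have := mul_le_mul_of_nonneg_left h6 (hw0 z hz)
    rw [le_div_iff₀ hK0] at h3
    linarith

/-! ### Sufficiency of the decay conditions. -/

theorem tendsto_norm_apply {α β : ℝ} (hα : 0 < α) {u φ X A B : ℂ → ℂ}
    (hφm : Set.MapsTo φ disk disk) {M : ℝ}
    (hXM : ∀ z ∈ disk, (1 - ‖z‖ ^ 2) ^ β * ‖X z‖ ≤ M)
    (hAM : ∀ z ∈ disk, (1 - ‖z‖ ^ 2) ^ β * ‖A z‖ ≤ M)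
    (hBM : ∀ z ∈ disk, (1 - ‖z‖ ^ 2) ^ β * ‖B z‖ ≤ M)
    (hA : limsup (fun n : ℕ => ENNReal.ofReal (((n : ℝ) + 1) ^ α) *
      weightedSup β (fun z => A z * φ z ^ n)) atTop = 0)
    (hB : limsup (fun n : ℕ => ENNReal.ofReal (((n : ℝ) + 1) ^ (α + 1)) *
      weightedSup β (fun z => B z * φ z ^ n)) atTop = 0)
    (h1 : α = 1 → limsup (fun n : ℕ => ENNReal.ofReal (Real.log n) *
      weightedSup β (fun z => X z * φ z ^ n)) atTop = 0)
    (h2 : 1 < α → limsup (fun n : ℕ => ENNReal.ofReal (((n : ℝ) + 1) ^ (α - 1)) *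
      weightedSup β (fun z => X z * φ z ^ n)) atTop = 0)
    {T : Bloch α →ₗ[ℂ] Zygmund β} (hT : IsWeightedComp u φ T)
    (hT1 : ∀ f : Bloch α, ∀ z ∈ disk, deriv (T f).toFun z
      = deriv u z * f.toFun (φ z) + u z * (deriv f.toFun (φ z) * deriv φ z))
    (hT2 : ∀ f : Bloch α, ∀ z ∈ disk, deriv (deriv (T f).toFun) z = X z * f.toFun (φ z)
      + A z * deriv f.toFun (φ z) + B z * deriv (deriv f.toFun) (φ z))
    {ι : Type*} {l : Filter ι} {H : ι → Bloch α} (hH2 : ∀ i, ‖H i‖ ≤ 2)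
    (hH : TendstoLocallyUniformlyOn (fun i => (H i).toFun) 0 l disk) :
    Tendsto (fun i => ‖T (H i)‖) l (𝓝 0) := by
  have hM : 0 ≤ M := (mul_nonneg (weight_pos' β zero_mem_disk).le (norm_nonneg _)).trans
    (hXM 0 zero_mem_disk)
  -- The value at 0 contributes 1, the derivative at 0 contributes 2, and the second derivative `5 +
  -- 2·2^(α+1)`, which covers both cases at the end.
  set K : ℝ := 8 + 2 * 2 ^ (α + 1) with hK
  have hK0 : 0 < K := by positivity
  suffices hs : ∀ ε > 0, ∀ᶠ i in l, ‖T (H i)‖ ≤ K * ε by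
    rw [Metric.tendsto_nhds]
    intro ε hε
    filter_upwards [hs (ε / (2 * K)) (by positivity)] with i hi
    have : K * (ε / (2 * K)) = ε / 2 := by field_simp
    rw [dist_zero_right, norm_norm]
    linarith
  intro ε hε
  obtain ⟨r₁, hr₁, hb₁⟩ := exists_boundary_apply_le hα hφm hM hXM h1 h2 hH2 hH hε
  obtain ⟨r₂, hr₂, hb₂⟩ := exists_boundary_rpow_le hα.le hφm hA hε
  obtain ⟨r₃, hr₃, hb₃⟩ := exists_boundary_rpow_le (by linarith) hφm hB hε
  -- Including `‖φ 0‖` lets the same uniform estimate control the value and derivative of `T (H i)`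
  -- at 0.
  set r := max (max r₁ r₂) (max r₃ ‖φ 0‖) with hr_def
  have hr : r < 1 := max_lt (max_lt hr₁ hr₂) (max_lt hr₃ (norm_lt_one (hφm zero_mem_disk)))
  set D := 1 + M + ‖u 0‖ + ‖deriv u 0‖ + ‖u 0‖ * ‖deriv φ 0‖ with hD
  have hD0 : 0 < D := by positivity
  have hsmall : ∀ {t : ℝ}, 0 ≤ t → t ≤ D → t * (ε / D) ≤ ε := by
    intro t _ ht
    rw [← mul_div_assoc, div_le_iff₀ hD0]
    nlinarith
  have hp1 : 0 ≤ ‖u 0‖ := norm_nonneg _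
  have hp2 : 0 ≤ ‖deriv u 0‖ := norm_nonneg _
  have hp3 : 0 ≤ ‖u 0‖ * ‖deriv φ 0‖ := by positivity
  filter_upwards [hb₁, Bloch.eventually_norm_le hH hr (ε := ε / D) (by positivity)] with i hi hsm
  have hφ0 := hsm (φ 0) ((le_max_right _ _).trans (le_max_right _ _))
  have e0 : ‖(T (H i)).toFun 0‖ ≤ ε := by
    rw [hT _ 0 zero_mem_disk, norm_mul]
    exact (mul_le_mul_of_nonneg_left hφ0.1 hp1).trans (hsmall hp1 (by linarith))
  have e1 : ‖deriv (T (H i)).toFun 0‖ ≤ 2 * ε := by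
    rw [hT1 _ 0 zero_mem_disk]
    refine (norm_add_le _ _).trans ?_
    rw [norm_mul, norm_mul, norm_mul]
    have a1 := (mul_le_mul_of_nonneg_left hφ0.1 hp2).trans (hsmall hp2 (by linarith))
    have a2 := (mul_le_mul_of_nonneg_left hφ0.2.1 hp3).trans (hsmall hp3 (by linarith))
    linarith
  refine (Zygmund.norm_le (c := (3 + (2 + 2 * 2 ^ (α + 1))) * ε) e0 e1 (by positivity)
    fun z hz => ?_).trans (by rw [hK]; linarith)
  have hw := weight_pos' β hz
  set w := (1 - ‖z‖ ^ 2) ^ β with hw_def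
  have hsum : w * ‖deriv (deriv (T (H i)).toFun) z‖ ≤ w * ‖X z‖ * ‖(H i).toFun (φ z)‖
      + w * ‖A z‖ * ‖deriv (H i).toFun (φ z)‖
      + w * ‖B z‖ * ‖deriv (deriv (H i).toFun) (φ z)‖ := by
    rw [hT2 _ z hz]
    calc _ ≤ w * (‖X z‖ * ‖(H i).toFun (φ z)‖ + ‖A z‖ * ‖deriv (H i).toFun (φ z)‖
          + ‖B z‖ * ‖deriv (deriv (H i).toFun) (φ z)‖) := by
          gcongr
          refine (norm_add₃_le).trans ?_
          rw [norm_mul, norm_mul, norm_mul]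
      _ = _ := by ring
  refine hsum.trans ?_
  have h2p : (0 : ℝ) < 2 ^ (α + 1) := by positivity
  by_cases hz' : r ≤ ‖φ z‖
  · have c1 := hi z hz (((le_max_left _ _).trans (le_max_left _ _)).trans hz')
    have c2 := hb₂ z hz (((le_max_right _ _).trans (le_max_left _ _)).trans hz')
    have c3 := hb₃ z hz (((le_max_left _ _).trans (le_max_right _ _)).trans hz')
    have hx : 0 < 1 - ‖φ z‖ := by linarith [norm_lt_one (hφm hz)]
    have d2 : ‖deriv (H i).toFun (φ z)‖ ≤ 2 * (1 - ‖φ z‖) ^ (-α) :=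
      ((H i).norm_deriv_le hα (hφm hz)).trans (by gcongr; exact hH2 i)
    have d3 : ‖deriv (deriv (H i).toFun) (φ z)‖
        ≤ 2 ^ (α + 1) * 2 * (1 - ‖φ z‖) ^ (-(α + 1)) :=
      ((H i).norm_deriv_deriv_le hα (hφm hz)).trans (by gcongr; exact hH2 i)
    have f2 : w * ‖A z‖ * ‖deriv (H i).toFun (φ z)‖ ≤ 2 * ε :=
      (mul_le_mul_of_nonneg_left d2 (by positivity)).trans (by linarith)
    have f3 : w * ‖B z‖ * ‖deriv (deriv (H i).toFun) (φ z)‖ ≤ 2 * 2 ^ (α + 1) * ε :=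
      (mul_le_mul_of_nonneg_left d3 (by positivity)).trans (by
        have := mul_le_mul_of_nonneg_left c3 (by positivity : 0 ≤ 2 * (2 : ℝ) ^ (α + 1))
        linarith)
    linarith
  · have hs := hsm (φ z) (not_le.1 hz').le
    have hMε := hsmall hM (by linarith)
    have hη : 0 ≤ ε / D := by positivity
    have c1 := (mul_le_mul (hXM z hz) hs.1 (norm_nonneg _) hM).trans hMε
    have c2 := (mul_le_mul (hAM z hz) hs.2.1 (norm_nonneg _) hM).trans hMε
    have c3 := (mul_le_mul (hBM z hz) hs.2.2 (norm_nonneg _) hM).trans hMε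
    have := mul_pos h2p hε
    linarith

/-- The image of the closed unit ball is itself compact: an ultrafilter on it is lifted to
preimages, whose local uniform limit `g` stays in the ball, and `T g` is the limit. The bound 2 is
that of `F y - g`. -/
theorem isCompactOperator_of_tendsto_norm {α β : ℝ} (hα : 0 < α) (T : Bloch α →ₗ[ℂ] Zygmund β)
    (hT : ∀ (U : Ultrafilter (Zygmund β)) (H : Zygmund β → Bloch α), (∀ i, ‖H i‖ ≤ 2) →
      TendstoLocallyUniformlyOn (fun i => (H i).toFun) 0 (U : Filter (Zygmund β)) disk →
      Tendsto (fun i => ‖T (H i)‖) U (𝓝 0)) : IsCompactOperator T := by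
  refine ⟨T '' Metric.closedBall 0 1, ?_, mem_of_superset
    (Metric.closedBall_mem_nhds 0 one_pos) (Set.subset_preimage_image _ _)⟩
  rw [isCompact_iff_ultrafilter_le_nhds']
  intro U hU
  have hex : ∀ y : Zygmund β, ∃ f : Bloch α, ‖f‖ ≤ 1 ∧
      (y ∈ T '' Metric.closedBall 0 1 → T f = y) := by
    intro y
    by_cases hy : y ∈ T '' Metric.closedBall 0 1
    · obtain ⟨f, hf, rfl⟩ := hy
      exact ⟨f, by simpa using hf, fun _ => rfl⟩
    · exact ⟨0, by simp, fun h => absurd h hy⟩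
  choose F hF1 hFT using hex
  obtain ⟨g, hg1, hg⟩ := Bloch.exists_tendstoLocallyUniformlyOn hα U F hF1
  refine ⟨T g, ⟨g, by simpa using hg1, rfl⟩, ?_⟩
  have ht := hT U (fun y => F y - g) (fun y => (norm_sub_le _ _).trans (by linarith [hF1 y])) (by
    rw [Metric.tendstoLocallyUniformlyOn_iff] at hg ⊢
    intro ε hε x hx
    obtain ⟨t, ht, h⟩ := hg ε hε x hx
    refine ⟨t, ht, h.mono fun y hy w hw => ?_⟩
    simpa [Bloch.toFun_sub] using hy w hw)
  have h3 : Tendsto (fun y => y) (U : Filter (Zygmund β)) (𝓝 (T g)) := by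
    rw [tendsto_iff_norm_sub_tendsto_zero]
    refine ht.congr' ?_
    filter_upwards [hU] with y hy
    rw [map_sub, hFT y hy]
  exact h3

/-! ### Necessity: compact operators and null sequences of monomials. -/

theorem tendsto_norm_of_isCompactOperator {α β : ℝ} (hβ : 0 < β) {u φ : ℂ → ℂ}
    (hφm : Set.MapsTo φ disk disk) {T : Bloch α →ₗ[ℂ] Zygmund β} (hT : IsWeightedComp u φ T)
    (hc : IsCompactOperator T) {F : ℕ → Bloch α} {C : ℝ} (hF : ∀ n, ‖F n‖ ≤ C)
    (h0 : ∀ z ∈ disk, Tendsto (fun n => (F n).toFun z) atTop (𝓝 0)) :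
    Tendsto (fun n => ‖T (F n)‖) atTop (𝓝 0) := by
  obtain ⟨K, hK, hKT⟩ := IsCompactOperator.image_closedBall_subset_compact hc C
  have hmem : ∀ n, T (F n) ∈ K := fun n => hKT ⟨F n, by simpa using hF n, rfl⟩
  refine tendsto_of_subseq_tendsto fun ns hns => ?_
  obtain ⟨g, -, ms, hmono, hg⟩ := hK.tendsto_subseq (fun n => hmem (ns n))
  have hms : Tendsto ms atTop atTop := hmono.tendsto_atTop
  have hgz : ∀ z ∈ disk, g.toFun z = 0 := by
    intro z hz
    obtain ⟨D, hD⟩ := Zygmund.exists_norm_apply_le hβ hz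
    have h1 : Tendsto (fun n => (T (F (ns (ms n)))).toFun z) atTop (𝓝 (g.toFun z)) := by
      rw [tendsto_iff_norm_sub_tendsto_zero]
      have h2 := (tendsto_iff_norm_sub_tendsto_zero.1 hg).const_mul D
      rw [mul_zero] at h2
      exact squeeze_zero (fun n => norm_nonneg _) (fun n => hD (T (F (ns (ms n))) - g)) h2
    have h3 : Tendsto (fun n => (T (F (ns (ms n)))).toFun z) atTop (𝓝 0) := by
      have h4 := ((h0 (φ z) (hφm hz)).comp (hns.comp hms)).const_mul (u z)
      rw [mul_zero] at h4
      exact h4.congr fun n => (hT _ z hz).symm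
    exact tendsto_nhds_unique h1 h3
  have hg0 : g = 0 := by
    refine Subtype.ext (funext fun z => ?_)
    by_cases hz : z ∈ disk
    · exact hgz z hz
    · exact g.mem.1.2 z hz
  refine ⟨ms, ?_⟩
  have := hg.norm
  rwa [hg0, norm_zero] at this

theorem rpow_mul_exp_neg_le {a y : ℝ} (ha : 0 < a) (hy : 0 ≤ y) :
    y ^ a * Real.exp (-y) ≤ a ^ a := by
  have h1 : y / a ≤ Real.exp (y / a) := by linarith [Real.add_one_le_exp (y / a)]
  have h2 := Real.rpow_le_rpow (by positivity) h1 ha.le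
  rw [Real.div_rpow hy ha.le, ← Real.exp_mul, div_mul_cancel₀ _ ha.ne',
    div_le_iff₀ (by positivity)] at h2
  rw [Real.exp_neg, ← div_eq_mul_inv, div_le_iff₀ (Real.exp_pos _)]
  linarith

/-- From `x ≤ exp(-(1-x))`, the product is controlled by `y^α exp(-y)` with `y = (n+1)(1-x)`.
Replacing `n` by `n+1` in the exponent costs the factor `e`, and `1-x² ≤ 2(1-x)` costs `2^α`. -/
theorem weight_mul_pow_le {α : ℝ} (hα : 0 < α) {z : ℂ} (hz : z ∈ disk) (n : ℕ) :
    (1 - ‖z‖ ^ 2) ^ α * (((n : ℝ) + 1) ^ α * ‖z‖ ^ n)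
      ≤ 2 ^ α * (Real.exp 1 * α ^ α) := by
  have hx1 := norm_lt_one hz
  have hx0 := norm_nonneg z
  set x := ‖z‖
  have e1 : (1 - x ^ 2) ^ α ≤ 2 ^ α * (1 - x) ^ α := by
    rw [← Real.mul_rpow (by norm_num) (by linarith)]
    exact Real.rpow_le_rpow (by nlinarith) (by nlinarith) hα.le
  have e2 : x ^ n ≤ Real.exp 1 * Real.exp (-(((n : ℝ) + 1) * (1 - x))) := by
    have h1 : x ≤ Real.exp (-(1 - x)) := by linarith [Real.add_one_le_exp (-(1 - x))]
    have h2 := pow_le_pow_left₀ hx0 h1 n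
    rw [← Real.exp_nat_mul] at h2
    rw [← Real.exp_add]
    refine h2.trans (Real.exp_le_exp.2 ?_)
    nlinarith
  have e3 := rpow_mul_exp_neg_le hα (y := ((n : ℝ) + 1) * (1 - x))
    (mul_nonneg (by positivity) (by linarith))
  rw [Real.mul_rpow (by positivity) (by linarith)] at e3
  have hp : 0 ≤ (1 - x) ^ α := Real.rpow_nonneg (by linarith) _
  calc (1 - x ^ 2) ^ α * (((n : ℝ) + 1) ^ α * x ^ n)
      ≤ (2 ^ α * (1 - x) ^ α) * (((n : ℝ) + 1) ^ α *
          (Real.exp 1 * Real.exp (-(((n : ℝ) + 1) * (1 - x))))) := by gcongr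
    _ = 2 ^ α * (Real.exp 1 * (((n : ℝ) + 1) ^ α * (1 - x) ^ α
          * Real.exp (-(((n : ℝ) + 1) * (1 - x))))) := by ring
    _ ≤ _ := by gcongr

theorem weight_le_one {α : ℝ} (hα : 0 < α) {z : ℂ} (hz : z ∈ disk) : (1 - ‖z‖ ^ 2) ^ α ≤ 1 :=
  Real.rpow_le_one (by nlinarith [norm_lt_one hz, norm_nonneg z])
    (by nlinarith [norm_nonneg z]) hα.le

theorem weightedSup_deriv_pow_lt_top {α : ℝ} (hα : 0 < α) (n : ℕ) :
    weightedSup α (deriv fun z : ℂ => z ^ n) < ∞ := by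
  refine (weightedSup_le (C := n) fun z hz => ?_).trans_lt ENNReal.ofReal_lt_top
  have h1 := weight_le_one hα hz
  have h2 : ‖deriv (fun z : ℂ => z ^ n) z‖ ≤ n := by
    simp only [deriv_pow_field, norm_mul, Complex.norm_natCast, norm_pow]
    exact mul_le_of_le_one_right (Nat.cast_nonneg n)
      (pow_le_one₀ (norm_nonneg z) (norm_lt_one hz).le)
  calc _ ≤ 1 * (n : ℝ) := mul_le_mul h1 h2 (norm_nonneg _) zero_le_one
    _ = n := one_mul _

/-- The monomial `z ↦ z ^ n` as an element of `𝓑^α`. -/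
def Bloch.monomial {α : ℝ} (hα : 0 < α) (n : ℕ) : Bloch α :=
  Bloch.ofFun (fun z => z ^ n) (by fun_prop) (weightedSup_deriv_pow_lt_top hα n)

theorem Bloch.norm_monomial_le {α : ℝ} (hα : 0 < α) (n : ℕ) :
    ((n : ℝ) + 1) ^ (α - 1) * ‖Bloch.monomial hα (n + 1)‖ ≤ 2 ^ α * (Real.exp 1 * α ^ α) := by
  have hn : (0 : ℝ) < (n : ℝ) + 1 := by positivity
  have hp : 0 < ((n : ℝ) + 1) ^ (α - 1) := by positivity
  rw [← le_div_iff₀' hp]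
  refine (Bloch.norm_ofFun_le (C := 2 ^ α * (Real.exp 1 * α ^ α) / ((n : ℝ) + 1) ^ (α - 1))
    (by positivity) fun z hz => ?_).trans_eq (by simp)
  rw [le_div_iff₀' hp]
  have := weight_mul_pow_le hα hz n
  have e : ((n : ℝ) + 1) ^ α = ((n : ℝ) + 1) ^ (α - 1) * ((n : ℝ) + 1) := by
    rw [← Real.rpow_add_one hn.ne']
    congr 1
    ring
  rw [e] at this
  have h3 : ‖deriv (fun z : ℂ => z ^ (n + 1)) z‖ = ((n : ℝ) + 1) * ‖z‖ ^ n := by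
    simp only [deriv_pow_field, norm_mul, norm_pow, Complex.norm_natCast]
    push_cast
    simp
  rw [h3]
  linarith

/-! ### Isolating the three coefficients. -/

section Coefficients

variable {α β : ℝ} {φ X A B : ℂ → ℂ} {T : Bloch α →ₗ[ℂ] Zygmund β}

/-- The truncated exponents `n - 1` and `n - 2` are harmless: whenever truncation occurs, the factor
in front vanishes. -/
theorem weight_mul_monomial_le (hα : 0 < α) (hφm : Set.MapsTo φ disk disk)
    (hT2 : ∀ f : Bloch α, ∀ z ∈ disk, deriv (deriv (T f).toFun) z = X z * f.toFun (φ z)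
      + A z * deriv f.toFun (φ z) + B z * deriv (deriv f.toFun) (φ z)) (n : ℕ) {z : ℂ}
    (hz : z ∈ disk) :
    (1 - ‖z‖ ^ 2) ^ β * ‖X z * φ z ^ n + A z * (n * φ z ^ (n - 1))
      + B z * (n * ((n - 1 : ℕ) * φ z ^ (n - 2)))‖ ≤ ‖T (Bloch.monomial hα n)‖ := by
  have h := (T (Bloch.monomial hα n)).weight_mul_deriv_deriv_le hz
  rw [hT2 _ z hz] at h
  have hd : deriv (fun z : ℂ => z ^ n) = fun z : ℂ => (n : ℂ) * z ^ (n - 1) := by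
    funext w
    simp
  have e0 : (Bloch.monomial hα n).toFun (φ z) = φ z ^ n := Bloch.ofFun_apply (hφm hz)
  have e1 : deriv (Bloch.monomial hα n).toFun (φ z) = n * φ z ^ (n - 1) := by
    refine (Bloch.deriv_ofFun (hφm hz)).trans ?_
    rw [hd]
  have e2 : deriv (deriv (Bloch.monomial hα n).toFun) (φ z)
      = n * ((n - 1 : ℕ) * φ z ^ (n - 2)) := by
    refine (Bloch.deriv_deriv_ofFun (hφm hz)).trans ?_
    rw [hd]
    simp [Nat.sub_sub]
  rwa [e0, e1, e2] at h

/-- The images of `1`, `z` and `z²` give a triangular system for `X`, `A`, `B`, solved using `|φ| <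
1`. -/
theorem exists_coefficient_bound (hα : 0 < α) (hφm : Set.MapsTo φ disk disk)
    (hT2 : ∀ f : Bloch α, ∀ z ∈ disk, deriv (deriv (T f).toFun) z = X z * f.toFun (φ z)
      + A z * deriv f.toFun (φ z) + B z * deriv (deriv f.toFun) (φ z)) :
    ∃ M : ℝ, ∀ z ∈ disk, (1 - ‖z‖ ^ 2) ^ β * ‖X z‖ ≤ M ∧ (1 - ‖z‖ ^ 2) ^ β * ‖A z‖ ≤ M ∧
      (1 - ‖z‖ ^ 2) ^ β * ‖B z‖ ≤ M := by
  set a := fun n => ‖T (Bloch.monomial hα n)‖ with ha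
  have ha0 : ∀ n, 0 ≤ a n := fun n => norm_nonneg _
  refine ⟨3 * a 0 + 2 * a 1 + a 2, fun z hz => ?_⟩
  have hw := weight_pos' β hz
  have hv := (norm_lt_one (hφm hz)).le
  have h0 := weight_mul_monomial_le hα hφm hT2 0 hz
  have h1 := weight_mul_monomial_le hα hφm hT2 1 hz
  have h2 := weight_mul_monomial_le hα hφm hT2 2 hz
  change _ ≤ a 0 at h0
  change _ ≤ a 1 at h1
  change _ ≤ a 2 at h2
  norm_num at h0 h1 h2
  set w := (1 - ‖z‖ ^ 2) ^ β
  have hmul : ∀ (t : ℂ), w * ‖t * φ z‖ ≤ w * ‖t‖ := fun t => by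
    rw [norm_mul]
    gcongr
    exact mul_le_of_le_one_right (norm_nonneg _) hv
  have k1 : w * ‖A z‖ ≤ a 0 + a 1 := by
    have e : A z = (X z * φ z + A z) - X z * φ z := by ring
    have := norm_sub_le (X z * φ z + A z) (X z * φ z)
    rw [← e] at this
    nlinarith [hmul (X z), mul_le_mul_of_nonneg_left this hw.le]
  have k2 : w * ‖B z‖ ≤ 3 * a 0 + 2 * a 1 + a 2 := by
    have e : B z * 2 = (X z * φ z ^ 2 + A z * (2 * φ z) + B z * 2) - X z * φ z * φ z
        - 2 * (A z * φ z) := by ring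
    have := (norm_sub_le ((X z * φ z ^ 2 + A z * (2 * φ z) + B z * 2) - X z * φ z * φ z)
      (2 * (A z * φ z))).trans (add_le_add_left (norm_sub_le _ _) _)
    rw [← e, norm_mul, norm_mul 2] at this
    norm_num only [Complex.norm_ofNat] at this
    have := mul_le_mul_of_nonneg_left this hw.le
    linarith [hmul (X z), hmul (A z), hmul (X z * φ z), mul_nonneg hw.le (norm_nonneg (B z))]
  exact ⟨by linarith [ha0 0, ha0 1, ha0 2], by linarith [ha0 0, ha0 1, ha0 2], k2⟩

/-- Once all three are brought to the common power `v^(3n)`, the second difference `S₁ - 2S₂ + S₃`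
kills `P` and `Q` and leaves `2n²R`; back-substitution gives `Q`, then `P`. -/
theorem separate_coefficients {w a b c : ℝ} (hw : 0 ≤ w) {v P Q R : ℂ} (hv : ‖v‖ ≤ 1) {n : ℕ}
    (hn : 1 ≤ n)
    (ha : w * ‖v ^ n * (P + n * Q + n * (n - 1) * R)‖ ≤ a)
    (hb : w * ‖v ^ (2 * n) * (P + (2 * n) * Q + (2 * n) * (2 * n - 1) * R)‖ ≤ b)
    (hc : w * ‖v ^ (3 * n) * (P + (3 * n) * Q + (3 * n) * (3 * n - 1) * R)‖ ≤ c) :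
    w * ‖v ^ (3 * n) * P‖ ≤ 6 * (a + b + c) ∧ n * (w * ‖v ^ (3 * n) * Q‖) ≤ 6 * (a + b + c) ∧
      (n : ℝ) ^ 2 * (w * ‖v ^ (3 * n) * R‖) ≤ 6 * (a + b + c) := by
  have hn1 : (1 : ℝ) ≤ n := by exact_mod_cast hn
  have hnC : ‖(n : ℂ)‖ = n := Complex.norm_natCast n
  set S₁ := v ^ (3 * n) * (P + n * Q + n * (n - 1) * R) with hS₁
  set S₂ := v ^ (3 * n) * (P + (2 * n) * Q + (2 * n) * (2 * n - 1) * R) with hS₂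
  set S₃ := v ^ (3 * n) * (P + (3 * n) * Q + (3 * n) * (3 * n - 1) * R) with hS₃
  have hpow : ∀ k (t : ℂ), w * ‖v ^ k * t‖ ≤ w * ‖t‖ := fun k t => by
    rw [norm_mul, norm_pow]
    gcongr
    exact mul_le_of_le_one_left (norm_nonneg _) (pow_le_one₀ (norm_nonneg _) hv)
  have h1 : w * ‖S₁‖ ≤ a := by
    have e : S₁ = v ^ (2 * n) * (v ^ n * (P + n * Q + n * (n - 1) * R)) := by
      rw [hS₁]; ring
    rw [e]
    exact (hpow _ _).trans ha
  have h2 : w * ‖S₂‖ ≤ b := by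
    have e : S₂ = v ^ n * (v ^ (2 * n) * (P + (2 * n) * Q + (2 * n) * (2 * n - 1) * R)) := by
      rw [hS₂]; ring
    rw [e]
    exact (hpow _ _).trans hb
  have p1 : 0 ≤ w * ‖S₁‖ := by positivity
  have p2 : 0 ≤ w * ‖S₂‖ := by positivity
  have p3 : 0 ≤ w * ‖S₃‖ := by positivity
  have hR : (n : ℝ) ^ 2 * (w * ‖v ^ (3 * n) * R‖) ≤ a + b + c := by
    have e : 2 * (n : ℂ) ^ 2 * (v ^ (3 * n) * R) = S₁ - 2 * S₂ + S₃ := by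
      rw [hS₁, hS₂, hS₃]; ring
    have e' := congrArg norm e
    rw [norm_mul, norm_mul, norm_pow, hnC, Complex.norm_ofNat] at e'
    have h4 : ‖S₁ - 2 * S₂ + S₃‖ ≤ ‖S₁‖ + 2 * ‖S₂‖ + ‖S₃‖ := by
      refine (norm_add_le _ _).trans (add_le_add_left ((norm_sub_le _ _).trans ?_) _)
      rw [norm_mul 2, Complex.norm_ofNat]
    have h5 := mul_le_mul_of_nonneg_left h4 hw
    rw [← e'] at h5
    linarith
  have hr0 : 0 ≤ w * ‖v ^ (3 * n) * R‖ := by positivity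
  have hQ : n * (w * ‖v ^ (3 * n) * Q‖) ≤ 4 * (a + b + c) := by
    have e : (n : ℂ) * (v ^ (3 * n) * Q)
        = S₂ - S₁ - ((3 * n ^ 2 - n : ℝ) : ℂ) * (v ^ (3 * n) * R) := by
      rw [hS₁, hS₂]; push_cast; ring
    have e' := congrArg norm e
    rw [norm_mul, hnC] at e'
    have h4 := (norm_sub_le (S₂ - S₁) (((3 * n ^ 2 - n : ℝ) : ℂ) * (v ^ (3 * n) * R))).trans
      (add_le_add_left (norm_sub_le _ _) _)
    rw [norm_mul (((3 * n ^ 2 - n : ℝ) : ℂ)), Complex.norm_real,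
      Real.norm_of_nonneg (by nlinarith)] at h4
    have h5 := mul_le_mul_of_nonneg_left h4 hw
    rw [← e'] at h5
    have h6 : 0 ≤ (n : ℝ) * (w * ‖v ^ (3 * n) * R‖) := by positivity
    linarith
  have hP : w * ‖v ^ (3 * n) * P‖ ≤ 6 * (a + b + c) := by
    have e : v ^ (3 * n) * P
        = S₁ - n * (v ^ (3 * n) * Q) - ((n ^ 2 - n : ℝ) : ℂ) * (v ^ (3 * n) * R) := by
      rw [hS₁]; push_cast; ring
    have h4 := (norm_sub_le (S₁ - n * (v ^ (3 * n) * Q))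
      (((n ^ 2 - n : ℝ) : ℂ) * (v ^ (3 * n) * R))).trans (add_le_add_left (norm_sub_le _ _) _)
    rw [← e, norm_mul (((n ^ 2 - n : ℝ) : ℂ)), Complex.norm_real,
      Real.norm_of_nonneg (by nlinarith), norm_mul (n : ℂ), hnC] at h4
    have h5 := mul_le_mul_of_nonneg_left h4 hw
    have h6 : 0 ≤ (n : ℝ) * (w * ‖v ^ (3 * n) * R‖) := by positivity
    linarith
  exact ⟨hP, by linarith, by linarith⟩

end Coefficients

theorem limsup_eq_zero_of_eventually_le {β : ℝ} {G φ : ℂ → ℂ} {c : ℕ → ℝ} (hc : ∀ n, 0 ≤ c n)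
    (h : ∀ ε > 0, ∀ᶠ n in atTop, ∀ z ∈ disk,
      c n * ((1 - ‖z‖ ^ 2) ^ β * ‖G z‖ * ‖φ z‖ ^ n) ≤ ε) :
    limsup (fun n => ENNReal.ofReal (c n) * weightedSup β (fun z => G z * φ z ^ n)) atTop = 0 := by
  refine Tendsto.limsup_eq (ENNReal.tendsto_nhds_zero.2 fun ε hε => ?_)
  by_cases hε' : ε = ∞
  · exact Eventually.of_forall fun n => by simp [hε']
  filter_upwards [h ε.toReal (ENNReal.toReal_pos hε.ne' hε')] with n hn
  unfold weightedSup
  rw [ENNReal.mul_iSup]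
  refine iSup_le fun z => ?_
  rw [← ENNReal.ofReal_mul (hc n), norm_mul, norm_pow, ← mul_assoc ((1 - ‖(z : ℂ)‖ ^ 2) ^ β)]
  exact ENNReal.ofReal_le_of_le_toReal (hn z z.2)

theorem limsup_rpow_eq_zero {β γ : ℝ} (hγ : 0 ≤ γ) {G φ : ℂ → ℂ} (hφm : Set.MapsTo φ disk disk)
    {δ : ℕ → ℝ} (hδ : Tendsto δ atTop (𝓝 0))
    (h : ∀ n : ℕ, 1 ≤ n → ∀ z ∈ disk,
      (n : ℝ) ^ γ * ((1 - ‖z‖ ^ 2) ^ β * ‖G z‖ * ‖φ z‖ ^ (5 * n)) ≤ δ n) :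
    limsup (fun n : ℕ => ENNReal.ofReal (((n : ℝ) + 1) ^ γ) *
      weightedSup β (fun z => G z * φ z ^ n)) atTop = 0 := by
  refine limsup_eq_zero_of_eventually_le (fun n => by positivity) fun ε hε => ?_
  have h1 : ∀ᶠ n in atTop, δ n < ε / 10 ^ γ := hδ.eventually_lt_const (by positivity)
  -- Every `m ≥ 5` is compared with `n = m / 5`: then `5n ≤ m` and `m + 1 ≤ 10n`, whence `10^γ`.
  have h2 : Tendsto (fun m : ℕ => m / 5) atTop atTop :=
    Nat.tendsto_div_const_atTop (by norm_num)
  filter_upwards [h2.eventually h1, eventually_ge_atTop 5] with m hm hm5 z hz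
  have hn : 1 ≤ m / 5 := by omega
  have h3 := h (m / 5) hn z hz
  set n := m / 5 with hn_def
  have hw := weight_pos' β hz
  have h4 : ((m : ℝ) + 1) ^ γ ≤ 10 ^ γ * (n : ℝ) ^ γ := by
    rw [← Real.mul_rpow (by norm_num) (by positivity)]
    refine Real.rpow_le_rpow (by positivity) ?_ hγ
    have : m + 1 ≤ 10 * n := by omega
    exact_mod_cast this
  have h5 : ‖φ z‖ ^ m ≤ ‖φ z‖ ^ (5 * n) :=
    pow_le_pow_of_le_one (norm_nonneg _) (norm_lt_one (hφm hz)).le (by omega)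
  calc ((m : ℝ) + 1) ^ γ * ((1 - ‖z‖ ^ 2) ^ β * ‖G z‖ * ‖φ z‖ ^ m)
      ≤ (10 ^ γ * (n : ℝ) ^ γ) * ((1 - ‖z‖ ^ 2) ^ β * ‖G z‖ * ‖φ z‖ ^ (5 * n)) := by gcongr
    _ = 10 ^ γ * ((n : ℝ) ^ γ * ((1 - ‖z‖ ^ 2) ^ β * ‖G z‖ * ‖φ z‖ ^ (5 * n))) := by ring
    _ ≤ 10 ^ γ * (ε / 10 ^ γ) := by gcongr; exact h3.trans hm.le
    _ = ε := by field_simp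

theorem tendsto_rpow_mul_pow {s x : ℝ} (hx0 : 0 ≤ x) (hx : x < 1) :
    Tendsto (fun n : ℕ => ((n : ℝ) + 1) ^ s * x ^ (n + 1)) atTop (𝓝 0) := by
  obtain ⟨k, hk⟩ := exists_nat_ge s
  have h1 : Tendsto (fun n : ℕ => ((n + 1 : ℕ) : ℝ) ^ k * x ^ (n + 1)) atTop (𝓝 0) :=
    (tendsto_add_atTop_iff_nat 1).2
      (tendsto_pow_const_mul_const_pow_of_abs_lt_one k (by rwa [abs_of_nonneg hx0]))
  refine squeeze_zero (fun n => by positivity) (fun n => ?_) h1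
  push_cast
  gcongr
  rw [← Real.rpow_natCast]
  exact Real.rpow_le_rpow_of_exponent_le (by linarith [Nat.cast_nonneg (α := ℝ) n]) hk

section Necessity

variable {α β : ℝ} {u φ X A B : ℂ → ℂ} {T : Bloch α →ₗ[ℂ] Zygmund β}

theorem tendsto_norm_monomial (hα : 0 < α) (hβ : 0 < β) (hφm : Set.MapsTo φ disk disk)
    (hT : IsWeightedComp u φ T) (hc : IsCompactOperator T) :
    Tendsto (fun n : ℕ => (n : ℝ) ^ (α - 1) * ‖T (Bloch.monomial hα n)‖) atTop (𝓝 0) := by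
  rw [← tendsto_add_atTop_iff_nat 1]
  have h := tendsto_norm_of_isCompactOperator hβ hφm hT hc
    (F := fun n : ℕ => ((((n : ℝ) + 1) ^ (α - 1) : ℝ) : ℂ) • Bloch.monomial hα (n + 1))
    (C := 2 ^ α * (Real.exp 1 * α ^ α)) (fun n => by
      rw [norm_smul, Complex.norm_real, Real.norm_of_nonneg (by positivity)]
      exact Bloch.norm_monomial_le hα n) (fun z hz => by
      rw [tendsto_zero_iff_norm_tendsto_zero]
      refine (tendsto_rpow_mul_pow (s := α - 1) (norm_nonneg z) (norm_lt_one hz)).congr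
        fun n => ?_
      have e : (Bloch.monomial hα (n + 1)).toFun z = z ^ (n + 1) := Bloch.ofFun_apply hz
      rw [Bloch.toFun_smul, Pi.smul_apply, smul_eq_mul, e, norm_mul, Complex.norm_real,
        Real.norm_of_nonneg (by positivity), norm_pow])
  refine h.congr fun n => ?_
  rw [map_smul, norm_smul, Complex.norm_real, Real.norm_of_nonneg (by positivity)]
  push_cast
  rfl

theorem limsup_coefficients_eq_zero (hα : 0 < α) (hβ : 0 < β) (hφm : Set.MapsTo φ disk disk)
    (hT : IsWeightedComp u φ T) (hc : IsCompactOperator T)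
    (hT2 : ∀ f : Bloch α, ∀ z ∈ disk, deriv (deriv (T f).toFun) z = X z * f.toFun (φ z)
      + A z * deriv f.toFun (φ z) + B z * deriv (deriv f.toFun) (φ z)) :
    limsup (fun n : ℕ => ENNReal.ofReal (((n : ℝ) + 1) ^ α) *
      weightedSup β (fun z => A z * φ z ^ n)) atTop = 0 ∧
    limsup (fun n : ℕ => ENNReal.ofReal (((n : ℝ) + 1) ^ (α + 1)) *
      weightedSup β (fun z => B z * φ z ^ n)) atTop = 0 ∧
    (1 < α → limsup (fun n : ℕ => ENNReal.ofReal (((n : ℝ) + 1) ^ (α - 1)) *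
      weightedSup β (fun z => X z * φ z ^ n)) atTop = 0) := by
  set a : ℕ → ℝ := fun n => ‖T (Bloch.monomial hα n)‖ with ha
  have hlim : Tendsto (fun n : ℕ => (n : ℝ) ^ (α - 1) * a n) atTop (𝓝 0) :=
    tendsto_norm_monomial hα hβ hφm hT hc
  have hlim_mul : ∀ k : ℕ, 0 < k →
      Tendsto (fun n : ℕ => (n : ℝ) ^ (α - 1) * a (k * n)) atTop (𝓝 0) := by
    intro k hk
    have h1 := (hlim.comp (tendsto_id.const_mul_atTop' hk)).const_mul (((k : ℝ) ^ (α - 1))⁻¹)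
    rw [mul_zero] at h1
    refine h1.congr fun n => ?_
    have hk' : (0 : ℝ) < k := by exact_mod_cast hk
    simp only [Function.comp, id]
    push_cast
    rw [Real.mul_rpow hk'.le (Nat.cast_nonneg n)]
    field_simp
  set δ : ℕ → ℝ := fun n => (n : ℝ) ^ (α - 1) * (6 * (a n + a (2 * n) + a (3 * n))) with hδ_def
  have hδ : Tendsto δ atTop (𝓝 0) := by
    have := ((hlim.add (hlim_mul 2 (by norm_num))).add (hlim_mul 3 (by norm_num))).const_mul 6
    simp only [add_zero, mul_zero] at this
    exact this.congr fun n => by rw [hδ_def]; ring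
  have hsep : ∀ n : ℕ, 1 ≤ n → ∀ z ∈ disk,
      (1 - ‖z‖ ^ 2) ^ β * ‖X z‖ * ‖φ z‖ ^ (5 * n) ≤ 6 * (a n + a (2 * n) + a (3 * n)) ∧
      n * ((1 - ‖z‖ ^ 2) ^ β * ‖A z‖ * ‖φ z‖ ^ (5 * n)) ≤ 6 * (a n + a (2 * n) + a (3 * n)) ∧
      (n : ℝ) ^ 2 * ((1 - ‖z‖ ^ 2) ^ β * ‖B z‖ * ‖φ z‖ ^ (5 * n))
        ≤ 6 * (a n + a (2 * n) + a (3 * n)) := by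
    intro n hn z hz
    have hw := weight_pos' β hz
    have hv := (norm_lt_one (hφm hz)).le
    have hv0 := norm_nonneg (φ z)
    -- An extra factor `φ z ^ 2` clears the exponents `k - 1` and `k - 2`. With the common power
    -- `3n` it gives at most `3n + 2 ≤ 5n`, the origin of the exponent `5n`.
    have hk : ∀ k : ℕ, 1 ≤ k → (1 - ‖z‖ ^ 2) ^ β * ‖φ z ^ k * (X z * φ z ^ 2 + k * (A z * φ z)
        + k * (k - 1) * B z)‖ ≤ a k := by
      intro k hk
      have h1 := weight_mul_monomial_le hα hφm hT2 k hz
      refine le_trans ?_ h1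
      gcongr
      have e : φ z ^ k * (X z * φ z ^ 2 + k * (A z * φ z) + k * (k - 1) * B z)
          = φ z ^ 2 * (X z * φ z ^ k + A z * (k * φ z ^ (k - 1))
            + B z * (k * ((k - 1 : ℕ) * φ z ^ (k - 2)))) := by
        rcases k with _ | _ | k
        · omega
        · simp; ring
        · simp only [Nat.add_sub_cancel, show k + 1 + 1 - 2 = k by omega]
          push_cast
          ring
      rw [e, norm_mul, norm_pow]
      exact mul_le_of_le_one_left (norm_nonneg _) (pow_le_one₀ hv0 hv)
    have h2 := hk (2 * n) (by omega)
    have h3 := hk (3 * n) (by omega)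
    push_cast at h2 h3
    obtain ⟨hP, hQ, hR⟩ := separate_coefficients hw.le hv hn (hk n hn) h2 h3
    rw [norm_mul, norm_pow, norm_mul, norm_pow] at hP
    rw [norm_mul, norm_pow, norm_mul] at hQ
    rw [norm_mul, norm_pow] at hR
    have q0 : ‖φ z‖ ^ (5 * n) ≤ ‖φ z‖ ^ (3 * n + 2) := pow_le_pow_of_le_one hv0 hv (by omega)
    have q1 : ‖φ z‖ ^ (5 * n) ≤ ‖φ z‖ ^ (3 * n + 1) := pow_le_pow_of_le_one hv0 hv (by omega)
    have q2 : ‖φ z‖ ^ (5 * n) ≤ ‖φ z‖ ^ (3 * n) := pow_le_pow_of_le_one hv0 hv (by omega)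
    refine ⟨le_trans ?_ hP, le_trans ?_ hQ, le_trans ?_ hR⟩
    · calc _ ≤ (1 - ‖z‖ ^ 2) ^ β * ‖X z‖ * ‖φ z‖ ^ (3 * n + 2) := by gcongr
        _ = _ := by ring
    · calc _ ≤ n * ((1 - ‖z‖ ^ 2) ^ β * ‖A z‖ * ‖φ z‖ ^ (3 * n + 1)) := by gcongr
        _ = _ := by ring
    · calc _ ≤ (n : ℝ) ^ 2 * ((1 - ‖z‖ ^ 2) ^ β * ‖B z‖ * ‖φ z‖ ^ (3 * n)) := by gcongr
        _ = _ := by ring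
  refine ⟨limsup_rpow_eq_zero hα.le hφm hδ fun n hn z hz => ?_,
    limsup_rpow_eq_zero (by linarith) hφm hδ fun n hn z hz => ?_,
    fun h1 => limsup_rpow_eq_zero (by linarith) hφm hδ fun n hn z hz => ?_⟩
  · have hn0 : (0 : ℝ) < n := by exact_mod_cast hn
    have e : (n : ℝ) ^ α = (n : ℝ) ^ (α - 1) * n := by
      rw [← Real.rpow_add_one hn0.ne', sub_add_cancel]
    rw [e, mul_assoc]
    exact mul_le_mul_of_nonneg_left (hsep n hn z hz).2.1 (by positivity)
  · have hn0 : (0 : ℝ) < n := by exact_mod_cast hn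
    have e : (n : ℝ) ^ (α + 1) = (n : ℝ) ^ (α - 1) * (n : ℝ) ^ 2 := by
      rw [← Real.rpow_natCast, ← Real.rpow_add hn0]
      congr 1
      push_cast
      ring
    rw [e, mul_assoc]
    exact mul_le_mul_of_nonneg_left (hsep n hn z hz).2.2 (by positivity)
  · exact mul_le_mul_of_nonneg_left (hsep n hn z hz).1 (by positivity)

end Necessity

/-! ### The case `α = 1`: logarithmic test functions. -/

/-- A segment of the Taylor expansion of `-log (1 - c z)`. -/
def logSegment (c : Circle) (m N : ℕ) (z : ℂ) : ℂ :=
  ∑ k ∈ Finset.Ico m N, ((c : ℂ) * z) ^ (k + 1) / ((k : ℂ) + 1)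

theorem hasDerivAt_logSegment (c : Circle) (m N : ℕ) (z : ℂ) :
    HasDerivAt (logSegment c m N) (∑ k ∈ Finset.Ico m N, (c : ℂ) ^ (k + 1) * z ^ k) z := by
  refine HasDerivAt.fun_sum fun k _ => ?_
  have h0 : ((k : ℂ) + 1) ≠ 0 := Nat.cast_add_one_ne_zero k
  have := ((((hasDerivAt_id z).const_mul (c : ℂ)).pow (k + 1)).div_const ((k : ℂ) + 1))
  convert! this using 1
  simp only [id, Nat.add_sub_cancel]
  push_cast
  field_simp
  rw [mul_pow]
  ring

theorem norm_logSegment_le (c : Circle) (m N : ℕ) {z : ℂ} (hz : z ∈ disk) :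
    ‖logSegment c m N z‖ ≤ ‖z‖ ^ m / (1 - ‖z‖) := by
  refine (norm_sum_le _ _).trans (le_trans (Finset.sum_le_sum fun k _ => ?_)
    (geom_sum_Ico_le_of_lt_one (norm_nonneg z) (norm_lt_one hz)))
  have h1 : ‖(k : ℂ) + 1‖ = (k : ℝ) + 1 := by
    exact_mod_cast Complex.norm_natCast (k + 1)
  rw [norm_div, norm_pow, norm_mul, Circle.norm_coe, one_mul, h1, div_le_iff₀ (by positivity)]
  have h2 : ‖z‖ ^ (k + 1) ≤ ‖z‖ ^ k :=
    pow_le_pow_of_le_one (norm_nonneg z) (norm_lt_one hz).le (Nat.le_succ k)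
  have h3 : 0 ≤ ‖z‖ ^ k * k := by positivity
  linarith

theorem weight_mul_deriv_logSegment_le (c : Circle) (m N : ℕ) {z : ℂ} (hz : z ∈ disk) :
    (1 - ‖z‖ ^ 2) ^ (1 : ℝ) * ‖deriv (logSegment c m N) z‖ ≤ 2 := by
  have hz1 := norm_lt_one hz
  have hz0 := norm_nonneg z
  have h1 : ‖deriv (logSegment c m N) z‖ ≤ ‖z‖ ^ m / (1 - ‖z‖) := by
    rw [(hasDerivAt_logSegment c m N z).deriv]
    refine (norm_sum_le _ _).trans (le_trans (Finset.sum_le_sum fun k _ => ?_)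
      (geom_sum_Ico_le_of_lt_one hz0 hz1))
    rw [norm_mul, norm_pow, norm_pow, Circle.norm_coe, one_pow, one_mul]
  have h2 : ‖z‖ ^ m / (1 - ‖z‖) ≤ 1 / (1 - ‖z‖) := by
    have : 0 < 1 - ‖z‖ := by linarith
    gcongr
    exact pow_le_one₀ hz0 hz1.le
  have h3 := h1.trans h2
  rw [le_div_iff₀ (by linarith)] at h3
  rw [Real.rpow_one]
  nlinarith [norm_nonneg (deriv (logSegment c m N) z)]

/-- `logSegment` as an element of the Bloch space. -/
def Bloch.logSegment (c : Circle) (m N : ℕ) : Bloch 1 :=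
  Bloch.ofFun (BlochZygmund.logSegment c m N)
    (fun z _ => (hasDerivAt_logSegment c m N z).differentiableAt.differentiableWithinAt)
    ((weightedSup_le fun _ hz => weight_mul_deriv_logSegment_le c m N hz).trans_lt
      ENNReal.ofReal_lt_top)

theorem Bloch.norm_logSegment_le (c : Circle) (m N : ℕ) : ‖Bloch.logSegment c m N‖ ≤ 2 := by
  refine (Bloch.norm_ofFun_le (by norm_num)
    fun z hz => weight_mul_deriv_logSegment_le c m N hz).trans_eq ?_
  simp [BlochZygmund.logSegment]

theorem harmonic_sub_harmonic {m N : ℕ} (h : m ≤ N) :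
    ∑ k ∈ Finset.Ico m N, ((k : ℝ) + 1)⁻¹ = (harmonic N : ℝ) - harmonic m := by
  rw [Finset.sum_Ico_eq_sub _ h]
  simp [harmonic]

/-- The rotation `c` turns `v` into `‖v‖`, so all terms are nonnegative and every power is at least
`‖v‖^N`. Starting at `√N` keeps a harmonic sum of at least `log N / 2 - 1`, which is at least `log N
/ 4` once `log N ≥ 4`, yet makes the segments tend to 0 pointwise. -/
theorem log_mul_pow_le_norm_logSegment {N : ℕ} (hN : 4 ≤ Real.log N) {v : ℂ} (hv : ‖v‖ ≤ 1) :
    ∃ c : Circle, Real.log N * ‖v‖ ^ N ≤ 4 * ‖logSegment c N.sqrt N v‖ := by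
  obtain ⟨ζ, hζ, hvζ⟩ := exists_unit_mul v
  obtain ⟨d, hd⟩ : ∃ d : Circle, (d : ℂ) = ζ := ⟨⟨ζ, mem_sphere_zero_iff_norm.2 hζ⟩, rfl⟩
  set c : Circle := d⁻¹ with hc
  have hcv : (c : ℂ) * v = (‖v‖ : ℂ) := by
    have h0 : ζ ≠ 0 := norm_ne_zero_iff.1 (by rw [hζ]; norm_num)
    rw [hc, Circle.coe_inv, hd, hvζ]
    simp only [norm_mul, hζ, mul_one, Complex.norm_real, norm_norm]
    field_simp
  refine ⟨c, ?_⟩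
  have hN0 : N ≠ 0 := by
    rintro rfl
    norm_num at hN
  have hm0 : 0 < N.sqrt := Nat.sqrt_pos.2 (Nat.pos_of_ne_zero hN0)
  have e : logSegment c N.sqrt N v
      = ((∑ k ∈ Finset.Ico N.sqrt N, ‖v‖ ^ (k + 1) / ((k : ℝ) + 1) : ℝ) : ℂ) := by
    rw [logSegment, hcv]
    push_cast
    rfl
  rw [e, Complex.norm_real, Real.norm_of_nonneg (Finset.sum_nonneg fun k _ => by positivity)]
  have h1 : ‖v‖ ^ N * ∑ k ∈ Finset.Ico N.sqrt N, ((k : ℝ) + 1)⁻¹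
      ≤ ∑ k ∈ Finset.Ico N.sqrt N, ‖v‖ ^ (k + 1) / ((k : ℝ) + 1) := by
    rw [Finset.mul_sum]
    refine Finset.sum_le_sum fun k hk => ?_
    rw [div_eq_mul_inv]
    gcongr ?_ * _
    exact pow_le_pow_of_le_one (norm_nonneg v) hv (Finset.mem_Ico.1 hk).2
  rw [harmonic_sub_harmonic (Nat.sqrt_le_self N)] at h1
  have h2 := log_add_one_le_harmonic N
  have h3 := harmonic_le_one_add_log N.sqrt
  have h4 : Real.log N ≤ Real.log ((N + 1 : ℕ) : ℝ) :=
    Real.log_le_log (by positivity) (by push_cast; linarith)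
  have h5 : 2 * Real.log N.sqrt ≤ Real.log N := by
    rw [show (2 : ℝ) * Real.log N.sqrt = Real.log ((N.sqrt : ℝ) ^ 2) by simp]
    refine Real.log_le_log (by positivity) ?_
    exact_mod_cast Nat.sqrt_le' N
  have h6 : Real.log N / 4 ≤ (harmonic N : ℝ) - harmonic N.sqrt := by linarith
  have h7 := mul_le_mul_of_nonneg_left h6 (by positivity : 0 ≤ ‖v‖ ^ N)
  linarith

section Log

variable {β : ℝ} {u φ X A B : ℂ → ℂ} {T : Bloch 1 →ₗ[ℂ] Zygmund β}

theorem eventually_norm_logSegment_le (hβ : 0 < β) (hφm : Set.MapsTo φ disk disk)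
    (hT : IsWeightedComp u φ T) (hc : IsCompactOperator T) {ε : ℝ} (hε : 0 < ε) :
    ∀ᶠ N : ℕ in atTop, ∀ c : Circle, ‖T (Bloch.logSegment c N.sqrt N)‖ ≤ ε := by
  -- The rotation needed later depends on `z`, so uniformity in `c` is required: for each `N` a bad
  -- rotation is picked whenever one exists, and compactness is applied to that sequence.
  have hex : ∀ N : ℕ, ∃ c : Circle, (∃ c' : Circle, ε < ‖T (Bloch.logSegment c' N.sqrt N)‖) →
      ε < ‖T (Bloch.logSegment c N.sqrt N)‖ := fun N => by
    by_cases h : ∃ c' : Circle, ε < ‖T (Bloch.logSegment c' N.sqrt N)‖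
    · obtain ⟨c, hc⟩ := h
      exact ⟨c, fun _ => hc⟩
    · exact ⟨1, fun h' => absurd h' h⟩
  choose c hcN using hex
  have hsqrt : Tendsto Nat.sqrt atTop atTop :=
    tendsto_atTop.2 fun k => by
      filter_upwards [eventually_ge_atTop (k * k)] with n hn using Nat.le_sqrt.2 hn
  have h := tendsto_norm_of_isCompactOperator hβ hφm hT hc
    (F := fun N : ℕ => Bloch.logSegment (c N) N.sqrt N)
    (fun N => Bloch.norm_logSegment_le _ _ _) (fun z hz => by
      have h1 := ((tendsto_pow_atTop_nhds_zero_of_lt_one (norm_nonneg z)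
        (norm_lt_one hz)).comp hsqrt).div_const (1 - ‖z‖)
      rw [zero_div] at h1
      refine squeeze_zero_norm (fun N => ?_) h1
      have e : (Bloch.logSegment (c N) N.sqrt N).toFun z = logSegment (c N) N.sqrt N z :=
        Bloch.ofFun_apply hz
      rw [e]
      exact norm_logSegment_le _ _ _ hz)
  filter_upwards [h.eventually_lt_const hε] with N hN c'
  by_contra hcon
  exact absurd hN (not_lt.2 (hcN N ⟨c', not_le.1 hcon⟩).le)

theorem limsup_log_eq_zero (hβ : 0 < β) (hφm : Set.MapsTo φ disk disk)
    (hT : IsWeightedComp u φ T) (hc : IsCompactOperator T)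
    (hT2 : ∀ f : Bloch 1, ∀ z ∈ disk, deriv (deriv (T f).toFun) z = X z * f.toFun (φ z)
      + A z * deriv f.toFun (φ z) + B z * deriv (deriv f.toFun) (φ z)) :
    limsup (fun n : ℕ => ENNReal.ofReal (Real.log n) *
      weightedSup β (fun z => X z * φ z ^ n)) atTop = 0 := by
  obtain ⟨hA, hB, -⟩ := limsup_coefficients_eq_zero one_pos hβ hφm hT hc hT2
  obtain ⟨M, hM⟩ := exists_coefficient_bound one_pos hφm hT2
  refine limsup_eq_zero_of_eventually_le (fun n => Real.log_natCast_nonneg n) fun ε hε => ?_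
  -- `44 = 4·(1 + 2 + 8)`: the contributions of `T f`, `A` and `B`, times the 4 of the logarithmic
  -- lower bound.
  set η := ε / 44 with hη_def
  have hη : 0 < η := by positivity
  obtain ⟨r₁, hr₁, hb₁⟩ := exists_boundary_rpow_le zero_le_one hφm hA hη
  obtain ⟨r₂, hr₂, hb₂⟩ := exists_boundary_rpow_le (by norm_num) hφm hB hη
  set r := max (max r₁ r₂) 0 with hr_def
  have hr0 : 0 ≤ r := le_max_right _ _
  have hr : r < 1 := max_lt (max_lt hr₁ hr₂) one_pos
  have hlog : Tendsto (fun n : ℕ => Real.log n) atTop atTop :=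
    Real.tendsto_log_atTop.comp tendsto_natCast_atTop_atTop
  have hsmall : Tendsto (fun n : ℕ => M * (n * r ^ n)) atTop (𝓝 0) := by
    have := (tendsto_self_mul_const_pow_of_lt_one hr0 hr).const_mul M
    rwa [mul_zero] at this
  have hM0 : 0 ≤ M := (mul_nonneg (weight_pos' β zero_mem_disk).le (norm_nonneg _)).trans
    (hM 0 zero_mem_disk).1
  filter_upwards [eventually_norm_logSegment_le hβ hφm hT hc hη, hlog.eventually_ge_atTop 4,
    hsmall.eventually_lt_const hε] with N hN hN4 hNs z hz
  have hw := weight_pos' β hz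
  have hlogN : 0 ≤ Real.log N := by linarith
  by_cases hz' : r ≤ ‖φ z‖
  · obtain ⟨c, hcN⟩ := log_mul_pow_le_norm_logSegment hN4 (norm_lt_one (hφm hz)).le
    set f := Bloch.logSegment c N.sqrt N with hf
    have hf2 : ‖f‖ ≤ 2 := Bloch.norm_logSegment_le _ _ _
    have e : f.toFun (φ z) = logSegment c N.sqrt N (φ z) := Bloch.ofFun_apply (hφm hz)
    rw [← e] at hcN
    have h1 := ((T f).weight_mul_deriv_deriv_le hz).trans (hN c)
    rw [hT2 f z hz] at h1
    have c2 := hb₁ z hz (((le_max_left _ _).trans (le_max_left _ _)).trans hz')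
    have c3 := hb₂ z hz (((le_max_right _ _).trans (le_max_left _ _)).trans hz')
    have hx : 0 < 1 - ‖φ z‖ := by linarith [norm_lt_one (hφm hz)]
    have d2 : ‖deriv f.toFun (φ z)‖ ≤ 2 * (1 - ‖φ z‖) ^ (-1 : ℝ) :=
      (f.norm_deriv_le one_pos (hφm hz)).trans (by gcongr)
    have d3 : ‖deriv (deriv f.toFun) (φ z)‖ ≤ 8 * (1 - ‖φ z‖) ^ (-(1 + 1) : ℝ) := by
      refine (f.norm_deriv_deriv_le one_pos (hφm hz)).trans ?_
      gcongr
      norm_num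
      linarith
    set w := (1 - ‖z‖ ^ 2) ^ β
    have f2 : w * ‖A z * deriv f.toFun (φ z)‖ ≤ 2 * η := by
      rw [norm_mul, ← mul_assoc]
      exact (mul_le_mul_of_nonneg_left d2 (by positivity)).trans (by linarith)
    have f3 : w * ‖B z * deriv (deriv f.toFun) (φ z)‖ ≤ 8 * η := by
      rw [norm_mul, ← mul_assoc]
      exact (mul_le_mul_of_nonneg_left d3 (by positivity)).trans (by linarith)
    have f1 : w * ‖X z * f.toFun (φ z)‖ ≤ 11 * η := by
      have e' : X z * f.toFun (φ z) = (X z * f.toFun (φ z) + A z * deriv f.toFun (φ z)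
          + B z * deriv (deriv f.toFun) (φ z)) - A z * deriv f.toFun (φ z)
          - B z * deriv (deriv f.toFun) (φ z) := by ring
      have h4 := (norm_sub_le ((X z * f.toFun (φ z) + A z * deriv f.toFun (φ z)
          + B z * deriv (deriv f.toFun) (φ z)) - A z * deriv f.toFun (φ z))
          (B z * deriv (deriv f.toFun) (φ z))).trans (add_le_add_left (norm_sub_le _ _) _)
      rw [← e'] at h4
      have := mul_le_mul_of_nonneg_left h4 hw.le
      linarith
    rw [norm_mul, ← mul_assoc] at f1
    have h5 := mul_le_mul_of_nonneg_left hcN (by positivity : 0 ≤ w * ‖X z‖)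
    calc Real.log N * (w * ‖X z‖ * ‖φ z‖ ^ N) = w * ‖X z‖ * (Real.log N * ‖φ z‖ ^ N) := by ring
      _ ≤ w * ‖X z‖ * (4 * ‖f.toFun (φ z)‖) := h5
      _ ≤ ε := by linarith
  -- Away from the boundary `log N ≤ N`, and `N r^N → 0` with `X` bounded in the weight.
  · have h1 : ‖φ z‖ ^ N ≤ r ^ N := pow_le_pow_left₀ (norm_nonneg _) (not_le.1 hz').le N
    have h2 : Real.log N ≤ N := Real.log_le_self (Nat.cast_nonneg N)
    calc Real.log N * ((1 - ‖z‖ ^ 2) ^ β * ‖X z‖ * ‖φ z‖ ^ N)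
        ≤ N * (M * r ^ N) := by
          gcongr
          exact (hM z hz).1
      _ ≤ ε := by linarith

end Log

end BlochZygmund

open BlochZygmund

theorem mainTheorem7 (α β : ℝ) (hα : 0 < α) (hβ : 0 < β) (u φ : ℂ → ℂ)
    (hu : DifferentiableOn ℂ u BlochZygmund.disk)
    (hφ : DifferentiableOn ℂ φ BlochZygmund.disk)
    (hφ_maps : Set.MapsTo φ BlochZygmund.disk BlochZygmund.disk) :
    BlochZygmund.CompactWeightedComp α β u φ ↔
      BlochZygmund.BoundedWeightedComp α β u φ ∧
      limsup (fun n : ℕ => ENNReal.ofReal (((n : ℝ) + 1) ^ α) *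
        BlochZygmund.weightedSup β (fun z =>
          (2 * deriv u z * deriv φ z + u z * deriv (deriv φ) z) * φ z ^ n)) atTop = 0 ∧
      limsup (fun n : ℕ => ENNReal.ofReal (((n : ℝ) + 1) ^ (α + 1)) *
        BlochZygmund.weightedSup β (fun z => u z * deriv φ z ^ 2 * φ z ^ n)) atTop = 0 ∧
      (α = 1 →
        limsup (fun n : ℕ => ENNReal.ofReal (Real.log n) *
          BlochZygmund.weightedSup β (fun z => deriv (deriv u) z * φ z ^ n)) atTop = 0) ∧
      (1 < α →
        limsup (fun n : ℕ => ENNReal.ofReal (((n : ℝ) + 1) ^ (α - 1)) *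
          BlochZygmund.weightedSup β (fun z => deriv (deriv u) z * φ z ^ n)) atTop = 0) := by
  have hderiv : ∀ T : Bloch α →ₗ[ℂ] Zygmund β, IsWeightedComp u φ T → ∀ f : Bloch α, ∀ z ∈ disk,
      deriv (T f).toFun z = deriv u z * f.toFun (φ z) + u z * (deriv f.toFun (φ z) * deriv φ z) ∧
      deriv (deriv (T f).toFun) z = deriv (deriv u) z * f.toFun (φ z)
        + (2 * deriv u z * deriv φ z + u z * deriv (deriv φ) z) * deriv f.toFun (φ z)
        + u z * deriv φ z ^ 2 * deriv (deriv f.toFun) (φ z) := fun T hT f z hz =>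
    deriv_deriv_weightedComp hu hφ hφ_maps f.mem.1.1 (hT f) hz
  constructor
  · rintro ⟨T, hT, hc⟩
    have hT2 := fun f z hz => (hderiv T hT f z hz).2
    obtain ⟨hA, hB, hX⟩ := limsup_coefficients_eq_zero
      (X := deriv (deriv u)) (A := fun z => 2 * deriv u z * deriv φ z + u z * deriv (deriv φ) z)
      (B := fun z => u z * deriv φ z ^ 2) hα hβ hφ_maps hT hc hT2
    refine ⟨⟨T, hT, ?_⟩, hA, hB, ?_, hX⟩
    · let S : Bloch α →L[ℂ] Zygmund β := ⟨T, hc.continuous⟩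
      exact ⟨‖S‖, S.le_opNorm⟩
    · rintro rfl
      exact limsup_log_eq_zero (X := deriv (deriv u))
        (A := fun z => 2 * deriv u z * deriv φ z + u z * deriv (deriv φ) z)
        (B := fun z => u z * deriv φ z ^ 2) hβ hφ_maps hT hc hT2
  · rintro ⟨⟨T, hT, -⟩, hA, hB, hX1, hX⟩
    have hT2 := fun f z hz => (hderiv T hT f z hz).2
    obtain ⟨M, hM⟩ := exists_coefficient_bound (X := deriv (deriv u))
      (A := fun z => 2 * deriv u z * deriv φ z + u z * deriv (deriv φ) z)
      (B := fun z => u z * deriv φ z ^ 2) hα hφ_maps hT2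
    refine ⟨T, hT, isCompactOperator_of_tendsto_norm hα T fun U H hH2 hH => ?_⟩
    exact tendsto_norm_apply (X := deriv (deriv u))
      (A := fun z => 2 * deriv u z * deriv φ z + u z * deriv (deriv φ) z)
      (B := fun z => u z * deriv φ z ^ 2) hα hφ_maps (fun z hz => (hM z hz).1)
      (fun z hz => (hM z hz).2.1) (fun z hz => (hM z hz).2.2) hA hB hX1 hX hT
      (fun f z hz => (hderiv T hT f z hz).1) hT2 hH2 hH
end
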